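/- There is a universal constant $\epsilon_0\in(0,1/2)$ such that for every $K>0$ there are constants $C>0$ and $k\in\mathbb N$, depending only on $K$, for which the following holds. Let $T\ge 1$ and $n$ be integers, $0<\epsilon\le\epsilon_0$, $\tau\in(0,1)$, and suppose $$n\;\ge\;2^T\cdot C\,(T/\epsilon)^k\cdot\log(2/\tau).$$ Then there is a (possibly randomized) online estimator $A$ such that for all probability distributions $X_1,\dots,X_T$ on $\mathbb R$ with unit variance that are sub-gaussian with parameter $K$, i.e. $$\Pr\big[|X_t-\mathbf E X_t|\ge q\big]\le 2\exp\!\big(-q^2/(2K^2)\big)\qquad\text{for all } q\ge 0,$$ $A$ robustly estimates the mean $\mu^*\in\mathbb R^T$ of the product distribution $X=X_1\otimes\cdots\otimes X_T$ under $\epsilon$-corruption in the $T$-round online setting with error $C\,\epsilon\sqrt{\log(1/\epsilon)}$ and failure probability $\tau$. Here the latter means the following. A clean collection of $n$ i.i.d. samples from $X$ is drawn; a (possibly randomized) adversary inspects all of it, replaces at most $\epsilon n$ of the samples by arbitrary points of $\mathbb R^T$, and lists the resulting samples $x^{(1)},\dots,x^{(n)}$ in any order. In round $t=1,\dots,T$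 the $t$-th coordinates $x^{(1)}_t,\dots,x^{(n)}_t$ are revealed and $A$ outputs a number $\mu_t$ that depends measurably on the coordinates revealed in rounds $1,\dots,t$ and on a random seed of $A$ that is independent of the samples and the adversary. Whatever the adversary does, $\big(\sum_{t=1}^T(\mu_t-\mu^*_t)^2\big)^{1/2}\le C\,\epsilon\sqrt{\log(1/\epsilon)}$ with probability at least $1-\tau$. -/

import Mathlib

open MeasureTheory ProbabilityTheory

/-- A data set of `n` samples in `ℝ^T`; `x i t` is the `t`-th coordinate of the `i`-th sample. -/
abbrev Dataset (n T : ℕ) : Type := Fin n → Fin T → ℝ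

/-- Strong contamination: `y` is an `ε`-corrupted version of `x` if it arises from the collection of
samples `x` by replacing at most `ε n` of them by arbitrary points. The samples form an unordered
collection, so the corrupted version may be listed in any order. -/
def IsCorruption {n T : ℕ} (ε : ℝ) (x y : Dataset n T) : Prop :=
  ∃ σ : Equiv.Perm (Fin n), (Set.ncard {i : Fin n | y i ≠ x (σ i)} : ℝ) ≤ ε * n

/-- A (possibly randomized) online estimator for `n` samples and `T` rounds, one coordinate being
revealed in each round. The internal randomness `Seed` is drawn once from `law`, and
`est t ω h` is the number output in round `t`, computed from the seed `ω` and from the history `h`,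
that is, the coordinates `0, …, t` of all `n` samples (and nothing else). -/
structure OnlineEstimator (n T : ℕ) where
  Seed : Type
  [measurableSeed : MeasurableSpace Seed]
  law : Measure Seed
  [isProbabilityMeasure_law : IsProbabilityMeasure law]
  est : (t : Fin T) → Seed → (Fin n → Set.Iic t → ℝ) → ℝ
  measurable_est : ∀ t, Measurable (fun p : Seed × (Fin n → Set.Iic t → ℝ) => est t p.1 p.2)

attribute [instance] OnlineEstimator.measurableSeed OnlineEstimator.isProbabilityMeasure_law

/-- The output of the estimator in round `t` when the data set `y` is revealed online. -/
def OnlineEstimator.output {n T : ℕ} (A : OnlineEstimator n T) (ω : A.Seed) (y : Dataset n T)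
    (t : Fin T) : ℝ :=
  A.est t ω (fun i s => y i s)

/-- `A` robustly estimates the mean of the distribution `P` on `ℝ^T` under `ε`-corruption in the
`T`-round online setting with error `err` and failure probability `τ`.

The adversary, which may be randomized, is given by a joint law `π` of the clean data set `p.1`
(`n` i.i.d. samples from `P`) and of an `ε`-corrupted version `p.2` of it; the seed of the estimator
is independent of both. The `ℓ₂` error of the outputs exceeds `err` with probability at
most `τ`. -/
def OnlineEstimator.RobustlyEstimates {n T : ℕ} (A : OnlineEstimator n T)
    (P : Measure (Fin T → ℝ)) (ε err τ : ℝ) : Prop :=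
  ∀ π : Measure (Dataset n T × Dataset n T),
    π.map Prod.fst = Measure.pi (fun _ : Fin n => P) →
    (∀ᵐ p ∂π, IsCorruption ε p.1 p.2) →
    (π.prod A.law)
      {q | err < √(∑ t : Fin T, (A.output q.2 q.1.2 t - ∫ x, x t ∂P) ^ 2)} ≤ ENNReal.ofReal τ

/-- `ν` is sub-gaussian with parameter `K`: its deviations from its mean have the tail bound
`Pr[|X - E X| ≥ q] ≤ 2 exp (- q² / (2 K²))`. -/
def IsSubgaussian (K : ℝ) (ν : Measure ℝ) : Prop :=
  Integrable id ν ∧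
    ∀ q : ℝ, 0 ≤ q →
      ν {x | q ≤ |x - ∫ z, z ∂ν|} ≤ ENNReal.ofReal (2 * Real.exp (-q ^ 2 / (2 * K ^ 2)))

/-! The estimator is deterministic. Each coordinate is centred at a rounded median `c` and cut into
slices of width `R = 8 K √(log (1 / ε))` on both sides of `c`. The mean is `c` plus `R` times the
sum over `j` of the differences of the two slice means (`IsSubgaussian.tendsto_sum_sliceMean`), and
slice `j` has values in `[0, 1]` and mean at most `ε ^ (4 * j)`. Shifted and divided by 3, the slice
value of a sample is read as the parameter of a fictitious bit. The bits are never drawn: only the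
average probability `mass` of each history of bits is used. Since the coordinates are independent,
the averages expected from clean data form the product law `cell` of the mean parameters
(`integral_historyProb`).

This leaves a problem about bits: find the parameters `p t` of independent bits online, from a law
`Y` of histories within ℓ¹ distance `η = 4 ε` of the product law `P`. The estimate is the median
over histories of the conditional probability of the next bit. If it is off by `δ t`, then half of
the mass sits on histories whose conditional probability is off by at least `δ t`. The potential `∑
h, ‖(l P h, Y h - P h)‖` with `l = 8 η` starts at `l`, ends below `l + η`, and does not decrease
when histories are split, by the triangle inequality. The defect of that inequality
(`triangle_defect`) makes it grow by order `δ t ^ 2 / (η p t + δ t)` in round `t`. So these terms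
sum to `O(η)` (`sum_sq_div_le`), whatever the number of rounds. For slice `j` this gives an ℓ² error
`O(ε ^ (j + 1))` (`clampedMedian_error`); summing over `j` and multiplying by `R` gives the claimed
error.

Closeness of `Y` and `P` means that all sets of histories have nearly the right average probability.
This follows from Hoeffding and a union bound over `2 ^ (2 ^ T)` sets, which is the source of the
factor `2 ^ T` in the sample size; corruption moves each average by at most `ε`. The centers depend
on the corrupted data, but rounding leaves only 7 candidates per coordinate, so the union bound
covers them too. -/

/-! ### Histories of independent bits. -/

/-- The probability that a Bernoulli variable of parameter `p` takes the value `b`. -/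
def bern (b : Bool) (p : ℝ) : ℝ := if b then p else 1 - p

/-- The probability of the history `h` for independent bits of parameters `ψ 0, ψ 1, …`. -/
def cell (ψ : ℕ → ℝ) (t : ℕ) (h : Fin t → Bool) : ℝ := ∏ s : Fin t, bern (h s) (ψ s)

/-- The history `h` followed by the bit `b`. -/
def push {t : ℕ} (h : Fin t → Bool) (b : Bool) : Fin (t + 1) → Bool :=
  Fin.snoc (α := fun _ => Bool) h b

@[simp] lemma bern_true (p : ℝ) : bern true p = p := if_pos rfl

@[simp] lemma bern_false (p : ℝ) : bern false p = 1 - p := if_neg Bool.false_ne_true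

lemma bern_nonneg {b : Bool} {p : ℝ} (h0 : 0 ≤ p) (h1 : p ≤ 1) : 0 ≤ bern b p := by
  unfold bern; split_ifs <;> linarith

lemma bern_pos {b : Bool} {p : ℝ} (h0 : 0 < p) (h1 : p < 1) : 0 < bern b p := by
  unfold bern; split_ifs <;> linarith

lemma cell_nonneg {ψ : ℕ → ℝ} (h0 : ∀ s, 0 ≤ ψ s) (h1 : ∀ s, ψ s ≤ 1) (t : ℕ)
    (h : Fin t → Bool) : 0 ≤ cell ψ t h :=
  Finset.prod_nonneg fun _ _ => bern_nonneg (h0 _) (h1 _)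

lemma cell_push (ψ : ℕ → ℝ) {t : ℕ} (h : Fin t → Bool) (b : Bool) :
    cell ψ (t + 1) (push h b) = cell ψ t h * bern b (ψ t) := by
  simp [cell, push, Fin.prod_univ_castSucc]

lemma sum_push {t : ℕ} (f : (Fin (t + 1) → Bool) → ℝ) :
    ∑ h, f h = ∑ h : Fin t → Bool, (f (push h true) + f (push h false)) := by
  rw [← (Fin.snocEquiv (fun _ : Fin (t + 1) => Bool)).sum_comp, Fintype.sum_prod_type,
    Finset.sum_comm]
  simp [push, Fin.snocEquiv]

lemma sum_cell (ψ : ℕ → ℝ) (t : ℕ) : ∑ h, cell ψ t h = 1 := by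
  induction t with
  | zero => simp [cell]
  | succ t ih =>
    rw [sum_push, ← ih]
    refine Finset.sum_congr rfl fun h _ => ?_
    rw [cell_push, cell_push, bern_true, bern_false]; ring

/-! ### The potential argument. -/

lemma sq_div_add_mono {a x y : ℝ} (ha : 0 < a) (hx : 0 ≤ x) (hxy : x ≤ y) :
    x ^ 2 / (a + x) ≤ y ^ 2 / (a + y) := by
  rw [div_le_div_iff₀ (by linarith) (by linarith)]
  nlinarith [mul_nonneg hx (sub_nonneg.2 hxy), mul_nonneg (mul_nonneg hx (sub_nonneg.2 hxy)) (hx.trans hxy),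
    mul_nonneg ha.le (mul_nonneg (add_nonneg hx (hx.trans hxy)) (sub_nonneg.2 hxy))]

/-- A quantitative form of the triangle inequality in the plane. -/
lemma triangle_defect (a₁ b₁ a₀ b₀ : ℝ) (h₁ : 0 < a₁) (h₀ : 0 < a₀) :
    (a₁ * (b₁ + b₀) - b₁ * (a₁ + a₀)) ^ 2 /
        (2 * √(a₁ ^ 2 + b₁ ^ 2) * ((a₁ + a₀) ^ 2 + (b₁ + b₀) ^ 2)) ≤
      √(a₁ ^ 2 + b₁ ^ 2) + √(a₀ ^ 2 + b₀ ^ 2) - √((a₁ + a₀) ^ 2 + (b₁ + b₀) ^ 2) := by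
  set x := √(a₁ ^ 2 + b₁ ^ 2) with hx
  set y := √(a₀ ^ 2 + b₀ ^ 2) with hy
  set z := √((a₁ + a₀) ^ 2 + (b₁ + b₀) ^ 2) with hz
  have hx2 : x ^ 2 = a₁ ^ 2 + b₁ ^ 2 := Real.sq_sqrt (by positivity)
  have hy2 : y ^ 2 = a₀ ^ 2 + b₀ ^ 2 := Real.sq_sqrt (by positivity)
  have hz2 : z ^ 2 = (a₁ + a₀) ^ 2 + (b₁ + b₀) ^ 2 := Real.sq_sqrt (by positivity)
  have hxp : 0 < x := Real.sqrt_pos.2 (by positivity)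
  have hyp : 0 < y := Real.sqrt_pos.2 (by positivity)
  have hzp : 0 < z := Real.sqrt_pos.2 (by positivity)
  rw [← hz2]
  -- With `v₁`, `v₀` the two vectors and `v` their sum, `d₁` and `d₀` are the inner products of `v₁`
  -- and `v₀` with `v`. The squared cross product factors as `(x z - d₁) (x z + d₁)`; Cauchy-Schwarz
  -- for `v₀` bounds the first factor by `z` times the defect, and for `v₁` the second by `2 x z`.
  set d₁ := a₁ * (a₁ + a₀) + b₁ * (b₁ + b₀) with hd1
  set d₀ := a₀ * (a₁ + a₀) + b₀ * (b₁ + b₀) with hd0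
  have hd : d₁ + d₀ = z ^ 2 := by rw [hz2]; ring
  have hcs0 : d₀ ≤ y * z := by
    apply le_of_sq_le_sq _ (by positivity)
    rw [mul_pow, hy2, hz2]
    nlinarith [sq_nonneg (a₀ * (b₁ + b₀) - b₀ * (a₁ + a₀))]
  have hcross : (a₁ * (b₁ + b₀) - b₁ * (a₁ + a₀)) ^ 2 = (x * z - d₁) * (x * z + d₁) := by
    have : (x * z - d₁) * (x * z + d₁) = x ^ 2 * z ^ 2 - d₁ ^ 2 := by ring
    rw [this, hx2, hz2]; ring
  have hcs1 : |d₁| ≤ x * z := by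
    apply abs_le_of_sq_le_sq _ (by positivity)
    rw [mul_pow, hx2, hz2]
    nlinarith [sq_nonneg (a₁ * (b₁ + b₀) - b₁ * (a₁ + a₀))]
  have hcs1' := abs_le.1 hcs1
  rw [div_le_iff₀ (by positivity), hcross]
  have h1 : x * z - d₁ ≤ (x + y - z) * z := by nlinarith
  have h2 : 0 ≤ x * z - d₁ := by linarith
  calc (x * z - d₁) * (x * z + d₁) ≤ ((x + y - z) * z) * (2 * (x * z)) := by
        apply mul_le_mul h1 (by linarith) (by linarith) (by linarith)
    _ = _ := by ring

/-- The gain of the potential at a history of mass `Y`, expected mass `P`, whose continuations by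
`1` have mass `Y₁` instead of about `p * Y`. -/
lemma potential_gain {l P Y Y₁ p δ : ℝ} (hl : 0 < l) (hl2 : l ≤ 1 / 2) (hP : 0 < P)
    (hp0 : 0 < p) (hp1 : p < 1) (hδ : 0 ≤ δ) (hn : |Y - P| ≤ l * P)
    (hY : δ * Y ≤ |Y₁ - p * Y|) :
    P * (δ ^ 2 / (32 * l * p + 8 * δ)) ≤
      √((l * (P * p)) ^ 2 + (Y₁ - P * p) ^ 2) +
        √((l * (P * (1 - p))) ^ 2 + ((Y - Y₁) - P * (1 - p)) ^ 2) -
        √((l * P) ^ 2 + (Y - P) ^ 2) := by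
  have hq : 0 < 1 - p := by linarith
  have h := triangle_defect (l * (P * p)) (Y₁ - P * p) (l * (P * (1 - p)))
    ((Y - Y₁) - P * (1 - p)) (by positivity) (by positivity)
  have e1 : l * (P * p) + l * (P * (1 - p)) = l * P := by ring
  have e2 : Y₁ - P * p + ((Y - Y₁) - P * (1 - p)) = Y - P := by ring
  rw [e1, e2] at h
  refine le_trans ?_ h
  set x := |Y₁ - p * Y| with hx
  have hx0 : 0 ≤ x := abs_nonneg _
  have e3 : (l * (P * p) * (Y - P) - (Y₁ - P * p) * (l * P)) ^ 2 = (l * P) ^ 2 * x ^ 2 := by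
    rw [hx, sq_abs]; ring
  rw [e3]
  have hn2 : (Y - P) ^ 2 ≤ (l * P) ^ 2 := sq_le_sq' (by linarith [abs_le.1 hn]) (abs_le.1 hn).2
  have hYP : P / 2 ≤ Y := by
    have := (abs_le.1 hn).1
    nlinarith
  have hv1 : √((l * (P * p)) ^ 2 + (Y₁ - P * p) ^ 2) ≤ 2 * l * P * p + x := by
    have h1 : |Y₁ - P * p| ≤ x + p * (l * P) := by
      have : Y₁ - P * p = (Y₁ - p * Y) + p * (Y - P) := by ring
      rw [this]
      refine (abs_add_le _ _).trans ?_
      rw [abs_mul, abs_of_pos hp0]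
      gcongr
    have h2 : (Y₁ - P * p) ^ 2 ≤ (x + p * (l * P)) ^ 2 := by
      rw [← sq_abs]; gcongr
    apply Real.sqrt_le_iff.2 ⟨by positivity, _⟩
    have : 0 ≤ (l * (P * p)) * (x + p * (l * P)) := by positivity
    nlinarith
  have hv1p : 0 < √((l * (P * p)) ^ 2 + (Y₁ - P * p) ^ 2) := Real.sqrt_pos.2 (by positivity)
  have step1 : x ^ 2 / (2 * l * P * p + x) / 4 ≤ (l * P) ^ 2 * x ^ 2 /
      (2 * √((l * (P * p)) ^ 2 + (Y₁ - P * p) ^ 2) * ((l * P) ^ 2 + (Y - P) ^ 2)) := by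
    calc x ^ 2 / (2 * l * P * p + x) / 4
        = (l * P) ^ 2 * x ^ 2 / (2 * (2 * l * P * p + x) * ((l * P) ^ 2 + (l * P) ^ 2)) := by
          field_simp; ring
      _ ≤ _ := by gcongr
  refine le_trans ?_ step1
  -- Here `Y ≥ P / 2` turns the assumed deviation into `x ≥ δ P / 2`.
  have hmono := sq_div_add_mono (a := 2 * l * P * p) (x := δ * (P / 2)) (y := x) (by positivity)
    (by positivity) ((mul_le_mul_of_nonneg_left hYP hδ).trans hY)
  calc P * (δ ^ 2 / (32 * l * p + 8 * δ))
      = (δ * (P / 2)) ^ 2 / (2 * l * P * p + δ * (P / 2)) / 4 := by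
        have : 32 * l * p + 8 * δ ≠ 0 := by positivity
        have : 2 * l * P * p + δ * (P / 2) ≠ 0 := by positivity
        have : 2 * l * p * 2 + δ ≠ 0 := by positivity
        have : l * p * 2 ^ 2 + δ ≠ 0 := by positivity
        field_simp
        ring
    _ ≤ _ := by gcongr

lemma sqrt_add_sq_le_add {a b : ℝ} (ha : 0 ≤ a) : √(a ^ 2 + b ^ 2) ≤ a + |b| := by
  apply Real.sqrt_le_iff.2 ⟨by positivity, _⟩
  rw [add_sq, sq_abs]
  have : 0 ≤ 2 * a * |b| := by positivity
  linarith

/-- The potential that controls the total error of the online estimate. -/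
noncomputable def potential (l : ℝ) (p : ℕ → ℝ) (Y : (t : ℕ) → (Fin t → Bool) → ℝ) (t : ℕ) : ℝ :=
  ∑ h, √((l * cell p t h) ^ 2 + (Y t h - cell p t h) ^ 2)

/-- Merging two continuations can only cancel differences, so the ℓ¹ bound at the final time holds
at all earlier times. -/
lemma sum_abs_sub_cell_mono {p : ℕ → ℝ} {Y : (t : ℕ) → (Fin t → Bool) → ℝ}
    (hY : ∀ t h, Y t h = Y (t + 1) (push h true) + Y (t + 1) (push h false)) (t : ℕ) :
    ∑ h, |Y t h - cell p t h| ≤ ∑ h, |Y (t + 1) h - cell p (t + 1) h| := by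
  rw [sum_push]
  refine Finset.sum_le_sum fun h _ => ?_
  rw [cell_push, cell_push, hY]
  refine le_trans (le_of_eq ?_) (abs_add_le _ _)
  rw [bern_true, bern_false]; congr 1; ring

/-- If half of the observed mass in every round `t` lies on histories for which the conditional
probability of the next bit is off by `δ t`, then `δ` is small. -/
theorem sum_sq_div_le {T : ℕ} {p δ : ℕ → ℝ} {Y : (t : ℕ) → (Fin t → Bool) → ℝ} {η : ℝ}
    (hp0 : ∀ t, 0 < p t) (hp1 : ∀ t, p t < 1) (hδ : ∀ t, 0 ≤ δ t)
    (hY : ∀ t h, Y t h = Y (t + 1) (push h true) + Y (t + 1) (push h false))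
    (hYone : ∀ h, Y 0 h = 1)
    (hη0 : 0 < η) (hη : η ≤ 1 / 16) (hTV : ∑ h, |Y T h - cell p T h| ≤ η)
    (hmed : ∀ t < T, 1 / 2 ≤ ∑ h : Fin t → Bool,
      if δ t * Y t h ≤ |Y (t + 1) (push h true) - p t * Y t h| then Y t h else 0) :
    ∑ t ∈ Finset.range T, δ t ^ 2 / (256 * η * p t + 8 * δ t) ≤ 4 * η := by
  -- The factor 8 makes the histories with `|Y - P| > l P` carry `P`-mass at most `1 / 8`, by
  -- Markov, while `η ≤ 1 / 16` still gives the `l ≤ 1 / 2` needed for `potential_gain`.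
  set l := 8 * η with hl
  have hcp : ∀ t h, 0 < cell p t h := fun t h =>
    Finset.prod_pos fun _ _ => bern_pos (hp0 _) (hp1 _)
  have hTVt : ∀ t ≤ T, ∑ h, |Y t h - cell p t h| ≤ η := fun t ht =>
    le_trans (monotone_nat_of_le_succ (f := fun t => ∑ h, |Y t h - cell p t h|)
      (sum_abs_sub_cell_mono hY) ht) hTV
  have hstep : ∀ t ∈ Finset.range T, δ t ^ 2 / (256 * η * p t + 8 * δ t) ≤
      4 * (potential l p Y (t + 1) - potential l p Y t) := by
    intro t ht
    rw [Finset.mem_range] at ht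
    set G := δ t ^ 2 / (256 * η * p t + 8 * δ t) with hG
    have hG0 : 0 ≤ G := by have := hp0 t; have := hδ t; positivity
    have hgain : ∀ h : Fin t → Bool,
        (if |Y t h - cell p t h| ≤ l * cell p t h ∧
          δ t * Y t h ≤ |Y (t + 1) (push h true) - p t * Y t h| then cell p t h * G else 0) ≤
        √((l * cell p (t + 1) (push h true)) ^ 2 +
            (Y (t + 1) (push h true) - cell p (t + 1) (push h true)) ^ 2) +
          √((l * cell p (t + 1) (push h false)) ^ 2 +
            (Y (t + 1) (push h false) - cell p (t + 1) (push h false)) ^ 2) -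
          √((l * cell p t h) ^ 2 + (Y t h - cell p t h) ^ 2) := by
      intro h
      have e : Y (t + 1) (push h false) = Y t h - Y (t + 1) (push h true) := by
        rw [hY t h]; ring
      rw [cell_push, cell_push, e, bern_true, bern_false]
      have hl0 : 0 < l := by positivity
      have hl2 : l ≤ 1 / 2 := by linarith
      split_ifs with hc
      · have := potential_gain hl0 hl2 (hcp t h) (hp0 t) (hp1 t) (hδ t) hc.1 hc.2
        have e2 : 32 * l * p t + 8 * δ t = 256 * η * p t + 8 * δ t := by rw [hl]; ring
        rw [e2] at this
        exact this
      -- On all other histories the plain triangle inequality gives a gain of at least 0.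
      · have h0 := hp0 t
        have h1 : 0 < 1 - p t := by linarith [hp1 t]
        have h2 := hcp t h
        have hd := triangle_defect (l * (cell p t h * p t)) (Y (t + 1) (push h true) - cell p t h * p t)
          (l * (cell p t h * (1 - p t)))
          ((Y t h - Y (t + 1) (push h true)) - cell p t h * (1 - p t)) (by positivity) (by positivity)
        have e1 : l * (cell p t h * p t) + l * (cell p t h * (1 - p t)) = l * cell p t h := by ring
        have e2 : Y (t + 1) (push h true) - cell p t h * p t +
          ((Y t h - Y (t + 1) (push h true)) - cell p t h * (1 - p t)) = Y t h - cell p t h := by ring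
        rw [e1, e2] at hd
        refine le_trans ?_ hd
        positivity
    -- Of the `Y`-mass `1 / 2`, at most `η ≤ 1 / 16` is lost in passing from `Y` to `P`, and at most
    -- `1 / 8` on histories where `Y` and `P` are not comparable.
    have hmass : 1 / 4 ≤ ∑ h : Fin t → Bool,
        (if |Y t h - cell p t h| ≤ l * cell p t h ∧
          δ t * Y t h ≤ |Y (t + 1) (push h true) - p t * Y t h| then cell p t h else 0) := by
      have hpt : ∀ h : Fin t → Bool,
          (if δ t * Y t h ≤ |Y (t + 1) (push h true) - p t * Y t h| then Y t h else 0) -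
            |Y t h - cell p t h| - |Y t h - cell p t h| / l ≤
          (if |Y t h - cell p t h| ≤ l * cell p t h ∧
            δ t * Y t h ≤ |Y (t + 1) (push h true) - p t * Y t h| then cell p t h else 0) := by
        intro h
        have hl0 : 0 < l := by positivity
        have ha := le_abs_self (Y t h - cell p t h)
        have hb : 0 ≤ |Y t h - cell p t h| / l := by positivity
        have h2 := hcp t h
        by_cases h3 : δ t * Y t h ≤ |Y (t + 1) (push h true) - p t * Y t h|
        · by_cases h4 : |Y t h - cell p t h| ≤ l * cell p t h
          · rw [if_pos h3, if_pos ⟨h4, h3⟩]; linarith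
          · rw [if_pos h3, if_neg (fun h => h4 h.1)]
            have : cell p t h ≤ |Y t h - cell p t h| / l := by
              rw [le_div_iff₀ hl0]; push Not at h4; linarith
            linarith
        · rw [if_neg h3, if_neg (fun h => h3 h.2)]
          have := abs_nonneg (Y t h - cell p t h)
          linarith
      refine le_trans ?_ (Finset.sum_le_sum fun h _ => hpt h)
      rw [Finset.sum_sub_distrib, Finset.sum_sub_distrib, ← Finset.sum_div]
      have h1 := hmed t ht
      have h2 := hTVt t ht.le
      have h3 : (∑ h : Fin t → Bool, |Y t h - cell p t h|) / l ≤ 1 / 8 := by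
        rw [div_le_iff₀ (by positivity)]; linarith
      linarith
    have hsum := Finset.sum_le_sum fun h (_ : h ∈ Finset.univ) => hgain h
    rw [Finset.sum_sub_distrib] at hsum
    unfold potential
    rw [sum_push]
    have e2 : (∑ h : Fin t → Bool, (if |Y t h - cell p t h| ≤ l * cell p t h ∧
          δ t * Y t h ≤ |Y (t + 1) (push h true) - p t * Y t h| then cell p t h * G else 0)) =
        (∑ h : Fin t → Bool, (if |Y t h - cell p t h| ≤ l * cell p t h ∧
          δ t * Y t h ≤ |Y (t + 1) (push h true) - p t * Y t h| then cell p t h else 0)) * G := by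
      rw [Finset.sum_mul]; refine Finset.sum_congr rfl fun h _ => ?_
      split_ifs <;> simp
    rw [e2] at hsum
    nlinarith
  refine (Finset.sum_le_sum hstep).trans ?_
  rw [← Finset.mul_sum, Finset.sum_range_sub]
  have h0 : potential l p Y 0 = l := by
    have : ∀ h : Fin 0 → Bool, √((l * cell p 0 h) ^ 2 + (Y 0 h - cell p 0 h) ^ 2) = l := by
      intro h
      rw [hYone]
      simp only [cell, Finset.univ_eq_empty, Finset.prod_empty, mul_one, sub_self]
      rw [zero_pow two_ne_zero, add_zero, Real.sqrt_sq (by positivity)]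
    unfold potential
    rw [Finset.sum_congr rfl fun h _ => this h]
    simp
  have h1 : potential l p Y T ≤ l + η := by
    calc potential l p Y T ≤ ∑ h, (l * cell p T h + |Y T h - cell p T h|) := by
          refine Finset.sum_le_sum fun h _ => sqrt_add_sq_le_add ?_
          have := hcp T h; positivity
      _ ≤ l + η := by
          rw [Finset.sum_add_distrib, ← Finset.mul_sum, sum_cell]; linarith
  linarith

/-! ### Weighted medians. -/

/-- A median of the values `q i` under the weights `w i`. -/
noncomputable def weightedMedian {ι : Type*} [Fintype ι] (w q : ι → ℝ) : ℝ :=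
  ⨅ i, if 1 / 2 ≤ ∑ j, (if q j ≤ q i then w j else 0) then q i else ⨆ j, q j

/-- At least half of the weight lies weakly on each side of the median; the points on the side away
from `a` are at least as far from `a` as the median is. -/
lemma weightedMedian_spec {ι : Type*} [Fintype ι] [Nonempty ι] {w q : ι → ℝ} (hw : ∀ i, 0 ≤ w i)
    (hsum : ∑ i, w i = 1) (a : ℝ) :
    1 / 2 ≤ ∑ i, if |weightedMedian w q - a| ≤ |q i - a| then w i else 0 := by
  classical
  set F : ℝ → ℝ := fun s => ∑ j, (if q j ≤ s then w j else 0) with hF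
  set f : ι → ℝ := fun i => if 1 / 2 ≤ F (q i) then q i else ⨆ j, q j with hf
  have hm : weightedMedian w q = ⨅ i, f i := rfl
  set m := weightedMedian w q with hmdef
  obtain ⟨k, hk⟩ := exists_eq_ciSup_of_finite (f := q)
  have hkF : F (q k) = 1 := by
    rw [hk, ← hsum]
    exact Finset.sum_congr rfl fun j _ => if_pos (le_ciSup (Set.finite_range q).bddAbove j)
  obtain ⟨i, hi⟩ := exists_eq_ciInf_of_finite (f := f)
  have hmi : m = f i := by rw [hm, hi]
  have hFm : 1 / 2 ≤ F m := by
    rw [hmi]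
    simp only [hf]
    split_ifs with h
    · exact h
    · rw [← hk, hkF]; norm_num
  have hmle : ∀ j, 1 / 2 ≤ F (q j) → m ≤ q j := by
    intro j hj
    rw [hm]
    refine (ciInf_le (Set.finite_range f).bddBelow j).trans ?_
    simp only [hf, if_pos hj, le_refl]
  have hFlt : ∑ j, (if q j < m then w j else 0) ≤ 1 / 2 := by
    by_cases hne : ∃ j, q j < m
    · have hne' : (Finset.univ.filter fun j => q j < m).Nonempty := by
        obtain ⟨j, hj⟩ := hne; exact ⟨j, by simpa using hj⟩
      -- The largest value below the median captures all the weight strictly below it, and its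
      -- cumulative weight is under `1 / 2`, since otherwise it would bound the median from above.
      obtain ⟨j, hj, hjmax⟩ := Finset.exists_max_image _ q hne'
      have hjm : q j < m := by simpa using hj
      have : F (q j) < 1 / 2 := by
        by_contra hcon; push Not at hcon; linarith [hmle j hcon]
      refine le_trans (Finset.sum_le_sum fun i _ => ?_) this.le
      by_cases h : q i < m
      · rw [if_pos h, if_pos (hjmax i (by simpa using h))]
      · rw [if_neg h]; split_ifs; exacts [hw i, le_rfl]
    · push Not at hne
      rw [Finset.sum_eq_zero fun j _ => if_neg (not_lt.2 (hne j))]; norm_num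
  have hFge : 1 / 2 ≤ ∑ j, (if m ≤ q j then w j else 0) := by
    have : ∑ j, (if m ≤ q j then w j else 0) + ∑ j, (if q j < m then w j else 0) = 1 := by
      rw [← Finset.sum_add_distrib, ← hsum]
      refine Finset.sum_congr rfl fun j _ => ?_
      by_cases h : m ≤ q j
      · rw [if_pos h, if_neg (not_lt.2 h), add_zero]
      · rw [if_neg h, if_pos (not_le.1 h), zero_add]
    linarith
  rcases le_total a m with ham | ham
  · refine hFge.trans (Finset.sum_le_sum fun j _ => ?_)
    by_cases h : m ≤ q j
    · rw [if_pos h, if_pos]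
      rw [abs_of_nonneg (by linarith), abs_of_nonneg (by linarith)]; linarith
    · rw [if_neg h]; split_ifs; exacts [hw j, le_rfl]
  · refine hFm.trans (Finset.sum_le_sum fun j _ => ?_)
    by_cases h : q j ≤ m
    · rw [if_pos h, if_pos]
      rw [abs_of_nonpos (by linarith), abs_of_nonpos (by linarith)]; linarith
    · rw [if_neg h]; split_ifs; exacts [hw j, le_rfl]

lemma measurable_weightedMedian {ι α : Type*} [Fintype ι] [MeasurableSpace α] {w q : ι → α → ℝ}
    (hw : ∀ i, Measurable (w i)) (hq : ∀ i, Measurable (q i)) :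
    Measurable fun x => weightedMedian (fun i => w i x) (fun i => q i x) := by
  unfold weightedMedian
  refine Measurable.iInf fun i => Measurable.ite ?_ (hq i) (Measurable.iSup hq)
  refine measurableSet_le measurable_const (Finset.measurable_sum _ fun j _ => ?_)
  exact Measurable.ite (measurableSet_le (hq j) (hq i)) (hw j) measurable_const

/-! ### Estimating the parameters of the bits. -/

/-- The fraction of the samples with history `h` when the bits of the `i`-th sample are independent
with parameters `ψ i 0, ψ i 1, …`. -/
noncomputable def mass {n : ℕ} (ψ : Fin n → ℕ → ℝ) (t : ℕ) (h : Fin t → Bool) : ℝ :=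
  (∑ i, cell (ψ i) t h) / n

/-- The median, over the histories, of the conditional probability of the bit `t`. -/
noncomputable def bitMedian {n : ℕ} (ψ : Fin n → ℕ → ℝ) (t : ℕ) : ℝ :=
  weightedMedian (mass ψ t) fun h => mass ψ (t + 1) (push h true) / mass ψ t h

/-- The median `bitMedian`, moved into the interval `[π / 3, 2 π / 3]`. -/
noncomputable def clampedMedian {n : ℕ} (π : ℝ) (ψ : Fin n → ℕ → ℝ) (t : ℕ) : ℝ :=
  max (π / 3) (min (2 * π / 3) (bitMedian ψ t))

lemma mass_nonneg {n : ℕ} {ψ : Fin n → ℕ → ℝ} (h0 : ∀ i s, 0 ≤ ψ i s) (h1 : ∀ i s, ψ i s ≤ 1)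
    (t : ℕ) (h : Fin t → Bool) : 0 ≤ mass ψ t h :=
  div_nonneg (Finset.sum_nonneg fun i _ => cell_nonneg (h0 i) (h1 i) t h) n.cast_nonneg

lemma sum_mass {n : ℕ} (hn : 0 < n) (ψ : Fin n → ℕ → ℝ) (t : ℕ) : ∑ h, mass ψ t h = 1 := by
  unfold mass
  rw [← Finset.sum_div, Finset.sum_comm, Finset.sum_congr rfl fun i _ => sum_cell (ψ i) t]
  simp [hn.ne']

lemma mass_eq_add {n : ℕ} (ψ : Fin n → ℕ → ℝ) (t : ℕ) (h : Fin t → Bool) :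
    mass ψ t h = mass ψ (t + 1) (push h true) + mass ψ (t + 1) (push h false) := by
  unfold mass
  rw [← add_div, ← Finset.sum_add_distrib]
  congr 1
  refine Finset.sum_congr rfl fun i _ => ?_
  rw [cell_push, cell_push, bern_true, bern_false]; ring

lemma abs_clamp_sub_le {a b m p : ℝ} (hap : a ≤ p) (hpb : p ≤ b) :
    |max a (min b m) - p| ≤ |m - p| := by
  rcases le_total b m with h1 | h1
  · rw [min_eq_left h1, max_eq_right (hap.trans hpb), abs_of_nonneg (by linarith),
      abs_of_nonneg (by linarith)]
    linarith
  · rw [min_eq_right h1]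
    rcases le_total a m with h2 | h2
    · rw [max_eq_right h2]
    · rw [max_eq_left h2, abs_of_nonpos (by linarith), abs_of_nonpos (by linarith)]
      linarith

/-- Apply the bound to the sets where `f` is nonnegative and negative. This turns bounds on sets of
histories into an ℓ¹ bound. -/
lemma sum_abs_le_two_mul {ι : Type*} [Fintype ι] {f : ι → ℝ} {c : ℝ}
    (h : ∀ A : Finset ι, |∑ i ∈ A, f i| ≤ c) : ∑ i, |f i| ≤ 2 * c := by
  classical
  rw [← Finset.sum_filter_add_sum_filter_not Finset.univ (fun i => 0 ≤ f i)]
  have h1 := (abs_le.1 (h (Finset.univ.filter fun i => 0 ≤ f i))).2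
  have h2 := (abs_le.1 (h (Finset.univ.filter fun i => ¬ 0 ≤ f i))).1
  have e1 : ∑ i ∈ Finset.univ.filter (fun i => 0 ≤ f i), |f i| =
      ∑ i ∈ Finset.univ.filter (fun i => 0 ≤ f i), f i :=
    Finset.sum_congr rfl fun i hi => abs_of_nonneg (Finset.mem_filter.1 hi).2
  have e2 : ∑ i ∈ Finset.univ.filter (fun i => ¬ 0 ≤ f i), |f i| =
      -∑ i ∈ Finset.univ.filter (fun i => ¬ 0 ≤ f i), f i := by
    rw [← Finset.sum_neg_distrib]
    exact Finset.sum_congr rfl fun i hi =>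
      abs_of_nonpos (not_le.1 (Finset.mem_filter.1 hi).2).le
  rw [e1, e2]; linarith

lemma bitMedian_spec {n : ℕ} (hn : 0 < n) {ψ : Fin n → ℕ → ℝ} (h0 : ∀ i s, 0 ≤ ψ i s)
    (h1 : ∀ i s, ψ i s ≤ 1) (t : ℕ) {p δ : ℝ} (hδ : δ ≤ |bitMedian ψ t - p|) :
    1 / 2 ≤ ∑ h : Fin t → Bool,
      if δ * mass ψ t h ≤ |mass ψ (t + 1) (push h true) - p * mass ψ t h| then mass ψ t h else 0 := by
  refine (weightedMedian_spec (mass_nonneg h0 h1 t) (sum_mass hn ψ t)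
    (q := fun h => mass ψ (t + 1) (push h true) / mass ψ t h) p).trans
    (Finset.sum_le_sum fun h _ => ?_)
  have hm := mass_nonneg h0 h1 t h
  rcases hm.eq_or_lt with hm0 | hm0
  -- A history of mass 0 has a meaningless quotient, but no weight in the median.
  · rw [← hm0]; simp
  · split_ifs with h2 h3 h3
    · rfl
    · refine absurd ?_ h3
      have h4 := hδ.trans h2
      calc δ * mass ψ t h ≤ |mass ψ (t + 1) (push h true) / mass ψ t h - p| * mass ψ t h := by
            gcongr
        _ = _ := by
            rw [← abs_of_pos hm0, ← abs_mul, abs_of_pos hm0, sub_mul, div_mul_cancel₀ _ hm0.ne']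
    · exact hm
    · rfl

/-- The online estimates of the probabilities of bits that are `1` with probability about
`ε ^ (4 * j)` have total error `O(ε ^ (j + 1))`. -/
theorem clampedMedian_error {n : ℕ} (hn : 0 < n) {ψ : Fin n → ℕ → ℝ} (h0 : ∀ i s, 0 ≤ ψ i s)
    (h1 : ∀ i s, ψ i s ≤ 1) {T j : ℕ} {p : ℕ → ℝ} {ε : ℝ} (hε0 : 0 < ε) (hε : ε ≤ 1 / 64)
    (hp0 : ∀ t, ε ^ (4 * j) / 3 ≤ p t) (hp1 : ∀ t, p t ≤ 2 * ε ^ (4 * j) / 3)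
    (hA : ∀ A : Finset (Fin T → Bool),
      |∑ h ∈ A, mass ψ T h - ∑ h ∈ A, cell p T h| ≤ 2 * ε) :
    √(∑ t ∈ Finset.range T, (clampedMedian (ε ^ (4 * j)) ψ t - p t) ^ 2) ≤ 189 * ε ^ (j + 1) := by
  set π := ε ^ (4 * j) with hπ
  have hπ0 : 0 < π := by positivity
  have hπ1 : π ≤ 1 := pow_le_one₀ hε0.le (by linarith)
  set δ : ℕ → ℝ := fun t => |clampedMedian π ψ t - p t| with hδ
  have hδ0 : ∀ t, 0 ≤ δ t := fun t => abs_nonneg _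
  have hδπ : ∀ t, δ t ≤ π / 3 := by
    intro t
    have a1 : π / 3 ≤ clampedMedian π ψ t := le_max_left _ _
    have a2 : clampedMedian π ψ t ≤ 2 * π / 3 := max_le (by linarith) (min_le_left _ _)
    have := hp0 t
    have := hp1 t
    exact abs_le.2 ⟨by linarith, by linarith⟩
  set η := 4 * ε with hη
  have hTV : ∑ h, |mass ψ T h - cell p T h| ≤ η := by
    have := sum_abs_le_two_mul (f := fun h => mass ψ T h - cell p T h) (c := 2 * ε)
      fun A => by rw [Finset.sum_sub_distrib]; exact hA A
    linarith
  have hp0' : ∀ t, 0 < p t := fun t => by have := hp0 t; linarith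
  have hmain := sum_sq_div_le (T := T) (p := p) (δ := δ) (Y := mass ψ) (η := η) hp0'
    (fun t => by have := hp1 t; linarith) hδ0 (mass_eq_add ψ)
    (fun h => by rw [← sum_mass hn ψ 0, Fintype.sum_subsingleton _ h])
    (by positivity) (by linarith) hTV
    (fun t _ => bitMedian_spec hn h0 h1 t (abs_clamp_sub_le (hp0 t) (hp1 t)))
  have hη0 : 0 < η := by positivity
  have hbound : ∀ D, (∀ t ∈ Finset.range T, δ t ≤ D) → 0 ≤ D →
      ∑ t ∈ Finset.range T, δ t ^ 2 ≤ 4 * η * (512 / 3 * η * π + 8 * D) := by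
    intro D hD hD0
    have hden : 0 < 512 / 3 * η * π + 8 * D := by positivity
    rw [← div_le_iff₀ hden, Finset.sum_div]
    refine le_trans (Finset.sum_le_sum fun t ht => ?_) hmain
    have := hp0' t
    have := hδ0 t
    have := hD t ht
    have := hp1 t
    apply div_le_div_of_nonneg_left (by positivity) (by positivity)
    nlinarith
  -- A single term of the sum gives `δ² ≤ 4 η (512 / 3 * η + 8 δ)`, which fails for `δ > 48 η`. This
  -- a priori bound is what makes the case `j = 0` quadratic in `η`.
  have hDη : ∀ t ∈ Finset.range T, δ t ≤ 48 * η := by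
    intro t ht
    have h2 := (Finset.single_le_sum (f := fun t => δ t ^ 2 / (256 * η * p t + 8 * δ t))
      (fun t _ => by have := hp0' t; have := hδ0 t; positivity) ht).trans hmain
    have h3 := hp0' t
    have h4 := hδ0 t
    have h5 : p t ≤ 2 / 3 := by have := hp1 t; linarith
    rw [div_le_iff₀ (by positivity)] at h2
    by_contra hcon
    push Not at hcon
    nlinarith [mul_nonneg hη0.le hη0.le, mul_le_mul_of_nonneg_left h5 (mul_nonneg hη0.le hη0.le)]
  -- For `j = 0` the bound is about `35500 ε²`, whence `189`. For `j ≥ 1` the trivial `δ ≤ π / 3`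
  -- suffices: the sum is `O(ε π)`, and `4 j + 1 ≥ 2 (j + 1)`.
  have hfin : ∑ t ∈ Finset.range T, δ t ^ 2 ≤ (189 * ε ^ (j + 1)) ^ 2 := by
    rcases Nat.eq_zero_or_pos j with hj | hj
    · have h2 := hbound (48 * η) hDη (by positivity)
      have h3 : η * π ≤ η := by nlinarith
      rw [hj, zero_add, pow_one]
      nlinarith
    · have h2 := hbound (π / 3) (fun t _ => hδπ t) (by positivity)
      have h3 : η * π ≤ π / 16 := by nlinarith
      have h4 : ε * π ≤ (ε ^ (j + 1)) ^ 2 := by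
        rw [hπ, ← pow_mul, ← pow_succ']
        exact pow_le_pow_of_le_one hε0.le (by linarith) (by lia)
      have h5 : 4 * η * (512 / 3 * η * π + 8 * (π / 3)) ≤ 4 * η * (512 / 3 * (π / 16) + 8 * (π / 3)) := by
        have : 512 / 3 * η * π = 512 / 3 * (η * π) := by ring
        rw [this]
        gcongr
      rw [mul_pow]
      have : 0 < ε * π := by positivity
      nlinarith
  have e : ∀ t, (clampedMedian π ψ t - p t) ^ 2 = δ t ^ 2 := fun t => (sq_abs _).symm
  simp only [e]
  exact (Real.sqrt_le_sqrt hfin).trans_eq (Real.sqrt_sq (by positivity))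

/-! ### Corruption and concentration of averages. -/

/-- The average of `f` over the samples. -/
noncomputable def avg {n : ℕ} {α : Type*} (f : α → ℝ) (x : Fin n → α) : ℝ := (∑ i, f (x i)) / n

lemma IsCorruption.abs_avg_sub_le {n T : ℕ} (hn : 0 < n) {ε : ℝ} {x y : Dataset n T}
    (h : IsCorruption ε x y) {f : (Fin T → ℝ) → ℝ} (h0 : ∀ a, 0 ≤ f a) (h1 : ∀ a, f a ≤ 1) :
    |avg f y - avg f x| ≤ ε := by
  classical
  obtain ⟨σ, hσ⟩ := h
  have hn' : (0 : ℝ) < n := by exact_mod_cast hn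
  have e : avg f x = (∑ i, f (x (σ i))) / n := by
    unfold avg; rw [Equiv.sum_comp σ fun i => f (x i)]
  rw [e]
  unfold avg
  rw [← sub_div, abs_div, abs_of_pos hn', div_le_iff₀ hn', ← Finset.sum_sub_distrib]
  refine (Finset.abs_sum_le_sum_abs _ _).trans ?_
  refine le_trans ?_ hσ
  rw [Set.ncard_eq_toFinset_card', Set.toFinset_ofPred, Finset.card_filter, Nat.cast_sum]
  refine Finset.sum_le_sum fun i _ => ?_
  split_ifs with hi
  · rw [Nat.cast_one]
    exact abs_le.2 ⟨by linarith [h0 (y i), h1 (x (σ i))], by linarith [h1 (y i), h0 (x (σ i))]⟩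
  · push Not at hi
    simp [hi]

/-- Hoeffding's inequality: a variable with values in `[0, 1]` is sub-gaussian with variance proxy
`1 / 4`. -/
lemma pi_avg_sub_integral_le {α : Type*} [MeasurableSpace α] {P : Measure α}
    [IsProbabilityMeasure P] {n : ℕ} (hn : 0 < n) {f : α → ℝ} (hf : Measurable f)
    (h0 : ∀ a, 0 ≤ f a) (h1 : ∀ a, f a ≤ 1) {ε : ℝ} (hε : 0 ≤ ε) :
    (Measure.pi fun _ : Fin n => P) {x | ε ≤ avg f x - ∫ a, f a ∂P} ≤
      ENNReal.ofReal (Real.exp (-(2 * n * ε ^ 2))) := by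
  have hn' : (0 : ℝ) < n := by exact_mod_cast hn
  have hind : iIndepFun (fun (i : Fin n) (x : Fin n → α) => f (x i) - ∫ a, f a ∂P)
      (Measure.pi fun _ : Fin n => P) :=
    iIndepFun_pi (X := fun _ a => f a - ∫ a, f a ∂P) fun _ => (hf.sub_const _).aemeasurable
  have hsub : ∀ i ∈ (Finset.univ : Finset (Fin n)),
      HasSubgaussianMGF (fun x : Fin n → α => f (x i) - ∫ a, f a ∂P) ((‖(1 : ℝ) - 0‖₊ / 2) ^ 2)
        (Measure.pi fun _ : Fin n => P) := by
    intro i _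
    have hmp := measurePreserving_eval (fun _ : Fin n => P) i
    have := hasSubgaussianMGF_of_mem_Icc (μ := Measure.pi fun _ : Fin n => P)
      (X := fun x => f (x i)) (a := 0) (b := 1) (hf.comp (measurable_pi_apply i)).aemeasurable
      (Filter.Eventually.of_forall fun x => ⟨h0 _, h1 _⟩)
    have e : ∫ x, f (x i) ∂(Measure.pi fun _ : Fin n => P) = ∫ a, f a ∂P := by
      rw [← hmp.map_eq, integral_map hmp.measurable.aemeasurable hf.aestronglyMeasurable]
      rw [hmp.map_eq]
    rwa [e] at this
  have h := HasSubgaussianMGF.measure_sum_ge_le_of_iIndepFun hind hsub (ε := n * ε) (by positivity)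
  rw [← ENNReal.ofReal_toReal (measure_ne_top _ _)]
  refine ENNReal.ofReal_le_ofReal (le_trans (le_of_eq ?_) (h.trans (le_of_eq ?_)))
  · unfold Measure.real
    congr 2
    ext x
    simp only [Set.mem_ofPred_eq, avg, Finset.sum_sub_distrib, Finset.sum_const, Finset.card_univ,
      Fintype.card_fin, nsmul_eq_mul]
    rw [le_sub_iff_add_le, le_div_iff₀ hn', le_sub_iff_add_le, add_mul]
    constructor <;> intro h <;> linarith
  · congr 1
    simp only [sub_zero, nnnorm_one, one_div, inv_pow, Finset.sum_const, Finset.card_univ,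
      Fintype.card_fin, nsmul_eq_mul]
    push_cast
    field_simp

/-- Uniform concentration of the averages of finitely many test functions. -/
lemma pi_exists_abs_avg_sub_integral_le {α ι : Type*} [Fintype ι] [MeasurableSpace α]
    {P : Measure α} [IsProbabilityMeasure P] {n : ℕ} (hn : 0 < n) {f : ι → α → ℝ}
    (hf : ∀ k, Measurable (f k)) (h0 : ∀ k a, 0 ≤ f k a) (h1 : ∀ k a, f k a ≤ 1) {ε : ℝ}
    (hε : 0 ≤ ε) :
    (Measure.pi fun _ : Fin n => P) {x | ∃ k, ε < |avg (f k) x - ∫ a, f k a ∂P|} ≤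
      ENNReal.ofReal (2 * Fintype.card ι * Real.exp (-(2 * n * ε ^ 2))) := by
  have hn' : (n : ℝ) ≠ 0 := by exact_mod_cast hn.ne'
  have hk : ∀ k, (Measure.pi fun _ : Fin n => P) {x | ε < |avg (f k) x - ∫ a, f k a ∂P|} ≤
      ENNReal.ofReal (2 * Real.exp (-(2 * n * ε ^ 2))) := by
    intro k
    have hint : Integrable (f k) P := Integrable.of_mem_Icc 0 1 (hf k).aemeasurable
      (Filter.Eventually.of_forall fun a => ⟨h0 k a, h1 k a⟩)
    have e : ∀ x : Fin n → α, avg (fun a => 1 - f k a) x - ∫ a, (1 - f k a) ∂P =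
        -(avg (f k) x - ∫ a, f k a ∂P) := by
      intro x
      rw [integral_sub (integrable_const _) hint]
      simp only [avg, Finset.sum_sub_distrib, Finset.sum_const, Finset.card_univ, Fintype.card_fin,
        nsmul_eq_mul, mul_one, integral_const, probReal_univ, smul_eq_mul, sub_div,
        div_self hn']
      ring
    have a1 := pi_avg_sub_integral_le (P := P) hn (hf k) (h0 k) (h1 k) hε
    have a2 := pi_avg_sub_integral_le (P := P) hn (f := fun a => 1 - f k a)
      (measurable_const.sub (hf k)) (fun a => by linarith [h1 k a]) (fun a => by linarith [h0 k a]) hε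
    simp only [e] at a2
    rw [two_mul, ENNReal.ofReal_add (by positivity) (by positivity)]
    refine le_trans (measure_mono ?_) ((measure_union_le _ _).trans (add_le_add a1 a2))
    intro x hx
    rcases lt_abs.1 (show ε < |avg (f k) x - ∫ a, f k a ∂P| from hx) with h | h
    · exact Or.inl h.le
    · exact Or.inr h.le
  rw [Set.ofPred_exists]
  refine (measure_iUnion_fintype_le _ _).trans ((Finset.sum_le_sum fun k _ => hk k).trans ?_)
  rw [Finset.sum_const, Finset.card_univ, nsmul_eq_mul, ← ENNReal.ofReal_natCast,
    ← ENNReal.ofReal_mul (by positivity)]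
  refine ENNReal.ofReal_le_ofReal (le_of_eq (by ring))

/-! ### Slicing a sub-gaussian variable. -/

/-- The number `r`, moved into the unit interval. -/
noncomputable def ramp (r : ℝ) : ℝ := max 0 (min 1 r)

/-- The sign that belongs to a side of the real line. -/
def side (b : Bool) : ℝ := if b then 1 else -1

lemma ramp_nonneg (r : ℝ) : 0 ≤ ramp r := le_max_left _ _

lemma ramp_le_one (r : ℝ) : ramp r ≤ 1 := max_le zero_le_one (min_le_left _ _)

lemma measurable_ramp : Measurable ramp :=
  measurable_const.max (measurable_const.min measurable_id)

lemma abs_side_mul (b : Bool) (x : ℝ) : |side b * x| = |x| := by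
  unfold side; split_ifs <;> simp

lemma sum_ramp (u : ℝ) (J : ℕ) : ∑ j ∈ Finset.range J, ramp (u - j) = max 0 (min (J : ℝ) u) := by
  induction J with
  | zero => simp
  | succ J ih =>
    rw [Finset.sum_range_succ, ih, ramp]
    push_cast
    have hJ : (0 : ℝ) ≤ J := J.cast_nonneg
    rcases le_total u 0 with h | h
    · rw [min_eq_right (by linarith), min_eq_right (by linarith), min_eq_right (by linarith),
        max_eq_left h, max_eq_left (by linarith), add_zero]
    · rcases le_total u J with h2 | h2
      · rw [min_eq_right h2, min_eq_right (by linarith), min_eq_right (by linarith),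
          max_eq_right h, max_eq_left (by linarith), add_zero]
      · rw [min_eq_left h2, max_eq_right hJ]
        rcases le_total u (J + 1) with h3 | h3
        · rw [min_eq_right (by linarith), min_eq_right (by linarith), max_eq_right (by linarith),
            max_eq_right h]; ring
        · rw [min_eq_left (by linarith), min_eq_left (by linarith), max_eq_right (by linarith),
            max_eq_right (by linarith)]

/-- The number `u`, moved into the interval `[-J, J]`, is a sum of numbers of modulus at most 1. -/
lemma sum_ramp_side (u : ℝ) (J : ℕ) :
    ∑ j ∈ Finset.range J, (ramp (side true * u - j) - ramp (side false * u - j)) =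
      max (-(J : ℝ)) (min (J : ℝ) u) := by
  rw [Finset.sum_sub_distrib, sum_ramp, sum_ramp]
  simp only [side, if_true, Bool.false_eq_true, if_false, one_mul, neg_one_mul]
  have hJ : (0 : ℝ) ≤ J := J.cast_nonneg
  rcases le_total u 0 with h | h
  · rw [min_eq_right (by linarith : u ≤ J), max_eq_left h, zero_sub]
    rcases le_total (-u) J with h2 | h2
    · rw [min_eq_right h2, max_eq_right (by linarith), max_eq_right (by linarith), neg_neg]
    · rw [min_eq_left h2, max_eq_right hJ, max_eq_left (by linarith)]
  · rw [min_eq_right (by linarith : -u ≤ J), max_eq_left (by linarith : -u ≤ 0), sub_zero,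
      max_eq_right (le_min hJ h), max_eq_right ((neg_nonpos.2 hJ).trans (le_min hJ h))]

/-- The mean of the `j`-th slice of width `R`, on one side of `c`. -/
noncomputable def sliceMean (ν : Measure ℝ) (R c : ℝ) (j : ℕ) (b : Bool) : ℝ :=
  ∫ x, ramp (side b * ((x - c) / R) - j) ∂ν

lemma measurable_slice (R c : ℝ) (j : ℕ) (b : Bool) :
    Measurable fun x : ℝ => ramp (side b * ((x - c) / R) - j) :=
  measurable_ramp.comp ((((measurable_id.sub_const c).div_const R).const_mul _).sub_const _)

lemma sliceMean_nonneg (ν : Measure ℝ) (R c : ℝ) (j : ℕ) (b : Bool) : 0 ≤ sliceMean ν R c j b :=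
  integral_nonneg fun _ => ramp_nonneg _

section
variable {ν : Measure ℝ} [IsProbabilityMeasure ν]

lemma integrable_slice (R c : ℝ) (j : ℕ) (b : Bool) :
    Integrable (fun x : ℝ => ramp (side b * ((x - c) / R) - j)) ν :=
  Integrable.of_mem_Icc 0 1 (measurable_slice R c j b).aemeasurable
    (Filter.Eventually.of_forall fun _ => ⟨ramp_nonneg _, ramp_le_one _⟩)

/-- The integrand is at most 1 and vanishes where `|x - c| < j R`. -/
lemma sliceMean_le_measureReal {R : ℝ} (hR : 0 < R) (c : ℝ) (j : ℕ) (b : Bool) :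
    sliceMean ν R c j b ≤ ν.real {x | j * R ≤ |x - c|} := by
  have hmeas : MeasurableSet {x : ℝ | j * R ≤ |x - c|} :=
    measurableSet_le measurable_const (measurable_id.sub_const c).abs
  rw [← integral_indicator_one hmeas]
  refine integral_mono (integrable_slice R c j b) ((integrable_const _).indicator hmeas) fun x => ?_
  by_cases hx : j * R ≤ |x - c|
  · simp only [Set.indicator, Set.mem_ofPred_eq, hx, if_true]
    exact ramp_le_one _
  · have : side b * ((x - c) / R) - j ≤ 0 := by
      push Not at hx
      have h1 : |side b * ((x - c) / R)| < j := by
        rw [abs_side_mul, abs_div, abs_of_pos hR, div_lt_iff₀ hR]; exact hx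
      linarith [(abs_lt.1 h1).2]
    simp only [Set.indicator, Set.mem_ofPred_eq, hx, if_false]
    simp [ramp, this]

lemma IsSubgaussian.measureReal_le {K ε c : ℝ} (hν : IsSubgaussian K ν) (hK : 0 < K)
    (hε0 : 0 < ε) (hε : ε ≤ 1 / 64) (hL : 1 ≤ Real.log (1 / ε))
    (hc : |c - ∫ z, z ∂ν| ≤ 4 * K) (j : ℕ) :
    ν.real {x | j * (8 * K * √(Real.log (1 / ε))) ≤ |x - c|} ≤ ε ^ (4 * j) := by
  rcases Nat.eq_zero_or_pos j with hj | hj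
  · rw [hj]; simp
  set L := Real.log (1 / ε) with hLdef
  have hj1 : (1 : ℝ) ≤ j := by exact_mod_cast hj
  have hsL : 1 ≤ √L := Real.one_le_sqrt.2 hL
  have hs2 : √L ^ 2 = L := Real.sq_sqrt (by linarith)
  have hq : (0 : ℝ) ≤ 4 * j * K * √L := by positivity
  have h1 := hν.2 (4 * j * K * √L) hq
  have hsubset : {x | j * (8 * K * √L) ≤ |x - c|} ⊆
      -- Moving the reference point from `c` to the mean costs `4 K`, at most half of the threshold
      -- `8 j K √L`.
      {x | 4 * j * K * √L ≤ |x - ∫ z, z ∂ν|} := by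
    intro x hx
    simp only [Set.mem_ofPred_eq] at hx ⊢
    have h2 : |x - c| ≤ |x - ∫ z, z ∂ν| + |c - ∫ z, z ∂ν| := by
      have := abs_sub_abs_le_abs_sub (x - c) (x - ∫ z, z ∂ν)
      have e : x - c - (x - ∫ z, z ∂ν) = -(c - ∫ z, z ∂ν) := by ring
      rw [e, abs_neg] at this; linarith
    have h3 : 4 * K ≤ 4 * j * K * √L := by
      have : 1 ≤ (j : ℝ) * √L := by nlinarith
      nlinarith
    linarith
  have h2 : ν.real {x | j * (8 * K * √L) ≤ |x - c|} ≤
      2 * Real.exp (-(4 * j * K * √L) ^ 2 / (2 * K ^ 2)) :=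
    ENNReal.toReal_le_of_le_ofReal (by positivity) ((measure_mono hsubset).trans h1)
  refine h2.trans ?_
  have e1 : -(4 * j * K * √L) ^ 2 / (2 * K ^ 2) = (8 * j ^ 2 : ℕ) * Real.log ε := by
    have : Real.log ε = -L := by rw [hLdef, one_div, Real.log_inv, neg_neg]
    rw [this]
    rw [mul_pow, hs2]
    push_cast
    field_simp
    ring
  rw [e1, Real.exp_nat_mul, Real.exp_log hε0]
  -- For `j ≥ 1`, `8 j² ≥ 4 j + 1`; the spare factor `ε` absorbs the 2 of the tail bound.
  have h3 : ε ^ (8 * j ^ 2) ≤ ε ^ (4 * j + 1) :=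
    pow_le_pow_of_le_one hε0.le (by linarith) (by nlinarith)
  rw [pow_succ ε] at h3
  have h4 : 0 < ε ^ (4 * j) := by positivity
  nlinarith

lemma IsSubgaussian.tendsto_sum_sliceMean {K R c : ℝ} (hν : IsSubgaussian K ν) :
    Filter.Tendsto (fun J : ℕ => ∑ j ∈ Finset.range J,
      (sliceMean ν R c j true - sliceMean ν R c j false)) Filter.atTop
      (nhds ((∫ z, z ∂ν - c) / R)) := by
  have hint : Integrable (fun x : ℝ => (x - c) / R) ν :=
    (hν.1.sub (integrable_const c)).div_const R
  have e : ∀ J : ℕ, ∑ j ∈ Finset.range J, (sliceMean ν R c j true - sliceMean ν R c j false) =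
      ∫ x, max (-(J : ℝ)) (min J ((x - c) / R)) ∂ν := by
    intro J
    rw [integral_congr_ae (Filter.Eventually.of_forall fun x => (sum_ramp_side ((x - c) / R) J).symm),
      integral_finsetSum (f := fun (j : ℕ) (x : ℝ) => ramp (side true * ((x - c) / R) - j) -
        ramp (side false * ((x - c) / R) - j)) _ fun j _ => (integrable_slice R c j true).sub (integrable_slice R c j false)]
    exact Finset.sum_congr rfl fun j _ =>
      (integral_sub (integrable_slice R c j true) (integrable_slice R c j false)).symm
  have hid : Integrable (fun x : ℝ => x) ν := hν.1
  have e2 : (∫ z, z ∂ν - c) / R = ∫ x, (x - c) / R ∂ν := by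
    rw [integral_div, integral_sub hid (integrable_const c)]; simp
  simp only [e]
  rw [e2]
  refine tendsto_integral_of_dominated_convergence (fun x => |(x - c) / R|) (fun J => ?_) hint.abs
    (fun J => Filter.Eventually.of_forall fun x => ?_) (Filter.Eventually.of_forall fun x => ?_)
  · exact (measurable_const.max (measurable_const.min
      ((measurable_id.sub_const c).div_const R))).aestronglyMeasurable
  · have := abs_clamp_sub_le (a := -(J : ℝ)) (b := J) (m := (x - c) / R) (p := 0) (by simp) (by simp)
    simpa using this
  · obtain ⟨N, hN⟩ := exists_nat_ge |(x - c) / R|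
    refine tendsto_const_nhds.congr' ?_
    filter_upwards [Filter.eventually_ge_atTop N] with J hJ
    have hJ' : |(x - c) / R| ≤ J := hN.trans (by exact_mod_cast hJ)
    have := abs_le.1 hJ'
    rw [min_eq_right this.2, max_eq_right this.1]

/-- The slices beyond `J` form a tail dominated by a geometric series of ratio `ε ^ 4 < 1 / 2`. -/
lemma IsSubgaussian.abs_sub_sum_sliceMean_le {K ε c : ℝ} (hν : IsSubgaussian K ν) (hK : 0 < K)
    (hε0 : 0 < ε) (hε : ε ≤ 1 / 64) (hL : 1 ≤ Real.log (1 / ε))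
    (hc : |c - ∫ z, z ∂ν| ≤ 4 * K) (J : ℕ) {R : ℝ} (hR : R = 8 * K * √(Real.log (1 / ε))) :
    |c + R * ∑ j ∈ Finset.range J, (sliceMean ν R c j true - sliceMean ν R c j false) -
      ∫ z, z ∂ν| ≤ 2 * R * ε ^ (4 * J) := by
  have hR0 : 0 < R := by rw [hR]; positivity
  have hγ : ∀ j b, sliceMean ν R c j b ≤ ε ^ (4 * j) := fun j b =>
    (sliceMean_le_measureReal hR0 c j b).trans
      (by rw [hR]; exact hν.measureReal_le hK hε0 hε hL hc j)
  have hr : ε ^ 4 < 1 / 2 := by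
    have : ε ^ 4 ≤ ε := pow_le_of_le_one hε0.le (by linarith) (by norm_num)
    linarith
  have h := dist_le_of_le_geometric_of_tendsto (ε ^ 4) 1 (by linarith)
    (f := fun J : ℕ => ∑ j ∈ Finset.range J, (sliceMean ν R c j true - sliceMean ν R c j false))
    (fun j => by
      rw [dist_comm, Real.dist_eq, Finset.sum_range_succ, add_sub_cancel_left, one_mul, ← pow_mul]
      have a1 := hγ j true
      have a2 := hγ j false
      have a3 := sliceMean_nonneg ν R c j true
      have a4 := sliceMean_nonneg ν R c j false
      exact abs_le.2 ⟨by linarith, by linarith⟩)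
    (hν.tendsto_sum_sliceMean (R := R) (c := c)) J
  rw [Real.dist_eq, one_mul, ← pow_mul] at h
  have h2 : ε ^ (4 * J) / (1 - ε ^ 4) ≤ 2 * ε ^ (4 * J) := by
    rw [div_le_iff₀ (by linarith)]
    have : 0 < ε ^ (4 * J) := by positivity
    nlinarith
  set S := ∑ j ∈ Finset.range J, (sliceMean ν R c j true - sliceMean ν R c j false)
  have e : c + R * S - ∫ z, z ∂ν = R * (S - (∫ z, z ∂ν - c) / R) := by field_simp; ring
  rw [e, abs_mul, abs_of_pos hR0]
  nlinarith
end

/-! ### The online estimator and its measurability. -/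

/-- The probability of the bit that represents the `j`-th slice of width `R` on a side of `c`. -/
noncomputable def bitParam (R ε c : ℝ) (j : ℕ) (b : Bool) (x : ℝ) : ℝ :=
  (ε ^ (4 * j) + ramp (side b * ((x - c) / R) - j)) / 3

/-- A rough estimate of the mean of coordinate `s`: the median, rounded to a multiple of `K`. -/
noncomputable def center {n : ℕ} (K : ℝ) (z : Fin n → ℕ → ℝ) (s : ℕ) : ℝ :=
  K * ⌊weightedMedian (fun _ : Fin n => (1 : ℝ) / n) (fun i => z i s) / K⌋

/-- The probabilities of the bits of all samples. -/
noncomputable def bits {n : ℕ} (K R ε : ℝ) (j : ℕ) (b : Bool) (z : Fin n → ℕ → ℝ) :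
    Fin n → ℕ → ℝ :=
  fun i s => bitParam R ε (center K z s) j b (z i s)

/-- The estimate of the mean of a slice. -/
noncomputable def sliceEstimate {n : ℕ} (K R ε : ℝ) (z : Fin n → ℕ → ℝ) (t j : ℕ) (b : Bool) : ℝ :=
  3 * clampedMedian (ε ^ (4 * j)) (bits K R ε j b z) t - ε ^ (4 * j)

/-- The estimate of the mean of coordinate `t`. -/
noncomputable def meanEstimate {n : ℕ} (K R ε : ℝ) (T : ℕ) (z : Fin n → ℕ → ℝ) (t : ℕ) : ℝ :=
  center K z t +
    R * ∑ j ∈ Finset.range T, (sliceEstimate K R ε z t j true - sliceEstimate K R ε z t j false)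

lemma cell_congr {ψ φ : ℕ → ℝ} {t : ℕ} (h : ∀ s < t, ψ s = φ s) (g : Fin t → Bool) :
    cell ψ t g = cell φ t g :=
  Finset.prod_congr rfl fun s _ => by rw [h s s.2]

lemma mass_congr {n : ℕ} {ψ φ : Fin n → ℕ → ℝ} {t : ℕ} (h : ∀ i, ∀ s < t, ψ i s = φ i s) :
    mass ψ t = mass φ t := by
  funext g
  unfold mass
  rw [Finset.sum_congr rfl fun i _ => cell_congr (h i) g]

/-- This is the online property: round `t` uses no coordinate after `t`, so extending a history by
zeros is harmless. -/
lemma meanEstimate_congr {n T : ℕ} {K R ε : ℝ} {z w : Fin n → ℕ → ℝ} {t : ℕ}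
    (h : ∀ i, ∀ s ≤ t, z i s = w i s) :
    meanEstimate K R ε T z t = meanEstimate K R ε T w t := by
  have hc : ∀ s ≤ t, center K z s = center K w s := fun s hs => by
    unfold center; simp only [h _ s hs]
  have hb : ∀ j b i, ∀ s ≤ t, bits K R ε j b z i s = bits K R ε j b w i s := fun j b i s hs => by
    unfold bits; rw [hc s hs, h i s hs]
  have hm : ∀ j b, bitMedian (bits K R ε j b z) t = bitMedian (bits K R ε j b w) t := fun j b => by
    unfold bitMedian
    rw [mass_congr fun i s hs => hb j b i s (le_of_lt hs),
      mass_congr fun i s hs => hb j b i s (Nat.lt_succ_iff.1 hs)]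
  unfold meanEstimate sliceEstimate clampedMedian
  simp only [hc t le_rfl, hm]

lemma measurable_bern {α : Type*} [MeasurableSpace α] (b : Bool) {f : α → ℝ} (hf : Measurable f) :
    Measurable fun a => bern b (f a) := by
  cases b
  · simp only [bern_false]; exact measurable_const.sub hf
  · simpa using hf

lemma measurable_cell {α : Type*} [MeasurableSpace α] {ψ : α → ℕ → ℝ}
    (hψ : ∀ s, Measurable fun a => ψ a s) (t : ℕ) (h : Fin t → Bool) :
    Measurable fun a => cell (ψ a) t h :=
  Finset.measurable_prod _ fun s _ => measurable_bern _ (hψ s)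

lemma measurable_bitParam {α : Type*} [MeasurableSpace α] (R ε : ℝ) (j : ℕ) (b : Bool)
    {c x : α → ℝ} (hc : Measurable c) (hx : Measurable x) :
    Measurable fun a => bitParam R ε (c a) j b (x a) :=
  ((measurable_ramp.comp ((((hx.sub hc).div_const R).const_mul _).sub_const _)).const_add _).div_const _

lemma measurable_meanEstimate {n : ℕ} (K R ε : ℝ) (T t : ℕ) :
    Measurable fun z : Fin n → ℕ → ℝ => meanEstimate K R ε T z t := by
  have hz : ∀ i s, Measurable fun z : Fin n → ℕ → ℝ => z i s := fun i s =>
    (measurable_pi_apply s).comp (measurable_pi_apply i)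
  have hc : ∀ s, Measurable fun z : Fin n → ℕ → ℝ => center K z s := fun s => by
    have h1 : Measurable fun z : Fin n → ℕ → ℝ =>
        weightedMedian (fun _ : Fin n => (1 : ℝ) / n) (fun i => z i s) :=
      measurable_weightedMedian (fun _ => measurable_const) (fun i => hz i s)
    have h2 : Measurable fun k : ℤ => (k : ℝ) := measurable_from_top
    exact (h2.comp (h1.div_const K).floor).const_mul K
  have hm : ∀ j b t h, Measurable fun z : Fin n → ℕ → ℝ => mass (bits K R ε j b z) t h :=
    fun j b t h => (Finset.measurable_sum _ fun i _ => measurable_cell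
      (fun s => measurable_bitParam R ε j b (hc s) (hz i s)) t h).div_const _
  have hs : ∀ j b, Measurable fun z : Fin n → ℕ → ℝ => sliceEstimate K R ε z t j b := fun j b =>
    ((measurable_const.max (measurable_const.min (measurable_weightedMedian (fun h => hm j b t h)
      fun h => (hm j b (t + 1) _).div (hm j b t h)))).const_mul 3).sub_const _
  exact (hc t).add ((Finset.measurable_sum _ fun j _ => (hs j true).sub (hs j false)).const_mul R)

/-- A sample, extended by zeros. -/
def extendZero {T : ℕ} (a : Fin T → ℝ) (s : ℕ) : ℝ := if h : s < T then a ⟨s, h⟩ else 0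

/-- The history of a sample, extended by zeros. -/
def extendHistory {T : ℕ} {t : Fin T} (v : Set.Iic t → ℝ) (s : ℕ) : ℝ :=
  if h : s ≤ t then v ⟨⟨s, h.trans_lt t.2⟩, h⟩ else 0

lemma measurable_extendZero {T : ℕ} (s : ℕ) : Measurable fun a : Fin T → ℝ => extendZero a s := by
  unfold extendZero
  split_ifs with h
  · exact measurable_pi_apply _
  · exact measurable_const

/-- The online estimator that outputs `meanEstimate`. -/
noncomputable def sliceEstimator (n T : ℕ) (K R ε : ℝ) : OnlineEstimator n T where
  Seed := Unit
  law := Measure.dirac ()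
  est t _ v := meanEstimate K R ε T (fun i => extendHistory (v i)) t
  measurable_est t := by
    refine (measurable_meanEstimate K R ε T t).comp ?_
    refine measurable_pi_lambda _ fun i => measurable_pi_lambda _ fun s => ?_
    unfold extendHistory
    split_ifs with h
    · exact (measurable_pi_apply _).comp ((measurable_pi_apply i).comp measurable_snd)
    · exact measurable_const

lemma sliceEstimator_output {n T : ℕ} {K R ε : ℝ} (ω : (sliceEstimator n T K R ε).Seed)
    (y : Dataset n T) (t : Fin T) :
    (sliceEstimator n T K R ε).output ω y t = meanEstimate K R ε T (fun i => extendZero (y i)) t := by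
  refine meanEstimate_congr fun i s hs => ?_
  simp only [extendHistory, extendZero]
  rw [dif_pos hs, dif_pos (lt_of_le_of_lt hs t.2)]

/-! ### Expected probabilities of histories. -/

lemma bitParam_nonneg {ε : ℝ} (hε0 : 0 < ε) (R c : ℝ) (j : ℕ) (b : Bool) (x : ℝ) :
    0 ≤ bitParam R ε c j b x := by
  have := ramp_nonneg (side b * ((x - c) / R) - j)
  unfold bitParam; positivity

lemma bitParam_le_one {ε : ℝ} (hε0 : 0 < ε) (hε1 : ε ≤ 1) (R c : ℝ) (j : ℕ) (b : Bool) (x : ℝ) :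
    bitParam R ε c j b x ≤ 1 := by
  have := ramp_le_one (side b * ((x - c) / R) - j)
  have : ε ^ (4 * j) ≤ 1 := pow_le_one₀ hε0.le hε1
  unfold bitParam; linarith

/-- The expectation of `bitParam`. -/
noncomputable def meanParam {T : ℕ} (ν : Fin T → Measure ℝ) (R ε : ℝ) (c : ℕ → ℝ) (j : ℕ)
    (b : Bool) (s : ℕ) : ℝ :=
  (ε ^ (4 * j) + if h : s < T then sliceMean (ν ⟨s, h⟩) R (c s) j b else 0) / 3

/-- The probability that the bits of the sample `a` form a history in `A`. -/
noncomputable def historyProb {T : ℕ} (R ε : ℝ) (c : ℕ → ℝ) (j : ℕ) (b : Bool)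
    (A : Finset (Fin T → Bool)) (a : Fin T → ℝ) : ℝ :=
  ∑ h ∈ A, cell (fun s => bitParam R ε (c s) j b (extendZero a s)) T h

lemma measurable_historyProb {T : ℕ} (R ε : ℝ) (c : ℕ → ℝ) (j : ℕ) (b : Bool)
    (A : Finset (Fin T → Bool)) : Measurable (historyProb R ε c j b A) :=
  Finset.measurable_sum _ fun h _ => measurable_cell (fun s =>
    measurable_bitParam R ε j b measurable_const (measurable_extendZero s)) T h

lemma historyProb_nonneg {T : ℕ} {ε : ℝ} (hε0 : 0 < ε) (hε1 : ε ≤ 1) (R : ℝ) (c : ℕ → ℝ) (j : ℕ)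
    (b : Bool) (A : Finset (Fin T → Bool)) (a : Fin T → ℝ) : 0 ≤ historyProb R ε c j b A a :=
  Finset.sum_nonneg fun h _ => cell_nonneg (fun _ => bitParam_nonneg hε0 _ _ _ _ _)
    (fun _ => bitParam_le_one hε0 hε1 _ _ _ _ _) T h

lemma historyProb_le_one {T : ℕ} {ε : ℝ} (hε0 : 0 < ε) (hε1 : ε ≤ 1) (R : ℝ) (c : ℕ → ℝ) (j : ℕ)
    (b : Bool) (A : Finset (Fin T → Bool)) (a : Fin T → ℝ) : historyProb R ε c j b A a ≤ 1 := by
  rw [← sum_cell (fun s => bitParam R ε (c s) j b (extendZero a s)) T]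
  exact Finset.sum_le_sum_of_subset_of_nonneg (Finset.subset_univ _) fun h _ _ =>
    cell_nonneg (fun _ => bitParam_nonneg hε0 _ _ _ _ _)
      (fun _ => bitParam_le_one hε0 hε1 _ _ _ _ _) T h

/-- For fixed centers a cell is a product of functions of single coordinates, each affine in its bit
parameter, so independence lets the expectation pass to the parameters. -/
lemma integral_historyProb {T : ℕ} {ν : Fin T → Measure ℝ} [∀ t, IsProbabilityMeasure (ν t)]
    {ε : ℝ} (hε0 : 0 < ε) (hε1 : ε ≤ 1) (R : ℝ) (c : ℕ → ℝ) (j : ℕ) (b : Bool)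
    (A : Finset (Fin T → Bool)) :
    ∫ a, historyProb R ε c j b A a ∂(Measure.pi ν) = ∑ h ∈ A, cell (meanParam ν R ε c j b) T h := by
  have h0 : ∀ (a : Fin T → ℝ) (s : ℕ), 0 ≤ bitParam R ε (c s) j b (extendZero a s) := fun a s =>
    bitParam_nonneg hε0 _ _ _ _ _
  have h1 : ∀ (a : Fin T → ℝ) (s : ℕ), bitParam R ε (c s) j b (extendZero a s) ≤ 1 := fun a s =>
    bitParam_le_one hε0 hε1 _ _ _ _ _
  have hi : ∀ h ∈ A, Integrable (fun a : Fin T → ℝ =>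
      cell (fun s => bitParam R ε (c s) j b (extendZero a s)) T h) (Measure.pi ν) := by
    intro h _
    refine Integrable.of_mem_Icc 0 1 (measurable_cell (fun s =>
      measurable_bitParam R ε j b measurable_const (measurable_extendZero s)) T h).aemeasurable
      (Filter.Eventually.of_forall fun a => ⟨cell_nonneg (h0 a) (h1 a) T h, ?_⟩)
    rw [← sum_cell (fun s => bitParam R ε (c s) j b (extendZero a s)) T]
    exact Finset.single_le_sum (fun g _ => cell_nonneg (h0 a) (h1 a) T g) (Finset.mem_univ h)
  unfold historyProb
  rw [integral_finsetSum _ hi]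
  refine Finset.sum_congr rfl fun h _ => ?_
  have e : ∀ a : Fin T → ℝ, cell (fun s => bitParam R ε (c s) j b (extendZero a s)) T h =
      ∏ s : Fin T, (fun (s : Fin T) (x : ℝ) => bern (h s) (bitParam R ε (c s) j b x)) s (a s) := by
    intro a
    refine Finset.prod_congr rfl fun s _ => ?_
    simp [extendZero]
  rw [integral_congr_ae (Filter.Eventually.of_forall e)]
  refine (integral_fintype_prod_eq_prod (𝕜 := ℝ)
    fun (s : Fin T) (x : ℝ) => bern (h s) (bitParam R ε (c s) j b x)).trans ?_
  refine Finset.prod_congr rfl fun s _ => ?_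
  have hint : Integrable (fun x => bitParam R ε (c s) j b x) (ν s) :=
    ((integrable_const _).add (integrable_slice R (c s) j b)).div_const 3
  have hmean : ∫ x, bitParam R ε (c s) j b x ∂(ν s) = meanParam ν R ε c j b s := by
    unfold bitParam meanParam sliceMean
    rw [integral_div, integral_add (integrable_const _) (integrable_slice R (c s) j b)]
    simp
  cases h s
  · simp only [bern_false]
    rw [integral_sub (integrable_const _) hint, hmean]; simp
  · simpa only [bern_true] using hmean

lemma avg_historyProb {n T : ℕ} (K R ε : ℝ) (y : Dataset n T) (j : ℕ) (b : Bool)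
    (A : Finset (Fin T → Bool)) :
    avg (historyProb R ε (center K fun i => extendZero (y i)) j b A) y =
      ∑ h ∈ A, mass (bits K R ε j b fun i => extendZero (y i)) T h := by
  unfold avg historyProb mass bits
  rw [Finset.sum_comm, Finset.sum_div]

/-- Otherwise half of the points would be at least as far from `m` as the median, hence at distance
at least `r`. -/
lemma abs_weightedMedian_sub_lt {n : ℕ} (hn : 0 < n) {q : Fin n → ℝ} {m r : ℝ}
    (h : (∑ i, if r ≤ |q i - m| then (1 : ℝ) else 0) / n < 1 / 2) :
    |weightedMedian (fun _ => (1 : ℝ) / n) q - m| < r := by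
  by_contra hcon
  push Not at hcon
  have : Nonempty (Fin n) := ⟨⟨0, hn⟩⟩
  have hn' : (n : ℝ) ≠ 0 := by exact_mod_cast hn.ne'
  have h1 := weightedMedian_spec (w := fun _ : Fin n => (1 : ℝ) / n) (q := q)
    (fun _ => by positivity) (by simp [hn']) m
  refine absurd h (not_lt.2 (h1.trans ?_))
  rw [Finset.sum_div]
  refine Finset.sum_le_sum fun i _ => ?_
  split_ifs with h2 h3 h3
  · rfl
  · exact absurd (hcon.trans h2) h3
  · positivity
  · simp

/-! ### Deterministic error bound. -/

/-- `√(∑ t, (f t) ^ 2)` is the Euclidean norm. -/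
lemma norm_toLp_eq {T : ℕ} (f : Fin T → ℝ) :
    ‖(WithLp.toLp 2 f : EuclideanSpace ℝ (Fin T))‖ = √(∑ t, f t ^ 2) := by
  rw [EuclideanSpace.norm_eq]; simp

lemma sum_pow_succ_le {ε : ℝ} (hε0 : 0 < ε) (hε : ε ≤ 1 / 2) (T : ℕ) :
    ∑ j ∈ Finset.range T, ε ^ (j + 1) ≤ 2 * ε := by
  have h1 : ∑ j ∈ Finset.range T, ε ^ j ≤ 2 := by
    rw [geom_sum_eq (by linarith), div_le_iff_of_neg (by linarith)]
    have : 0 ≤ ε ^ T := by positivity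
    linarith
  simp only [pow_succ, ← Finset.sum_mul]
  nlinarith

/-- The error of the estimator on a data set on which the test functions have about the right
averages. -/
theorem meanEstimate_error {n T : ℕ} (hn : 0 < n) (hT : 0 < T) {ν : Fin T → Measure ℝ}
    [∀ t, IsProbabilityMeasure (ν t)] {K R ε : ℝ} (hK : 0 < K) (hν : ∀ t, IsSubgaussian K (ν t))
    (hε0 : 0 < ε) (hε : ε ≤ 1 / 64) (hL : 1 ≤ Real.log (1 / ε))
    (hR : R = 8 * K * √(Real.log (1 / ε))) {y : Dataset n T}
    (hc : ∀ t : Fin T, |center K (fun i => extendZero (y i)) t - ∫ z, z ∂(ν t)| ≤ 4 * K)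
    (hA : ∀ j < T, ∀ b, ∀ A : Finset (Fin T → Bool),
      |avg (historyProb R ε (center K fun i => extendZero (y i)) j b A) y -
        ∫ a, historyProb R ε (center K fun i => extendZero (y i)) j b A a ∂(Measure.pi ν)| ≤
      2 * ε) :
    √(∑ t : Fin T, (meanEstimate K R ε T (fun i => extendZero (y i)) t - ∫ z, z ∂(ν t)) ^ 2) ≤
      18160 * K * (ε * √(Real.log (1 / ε))) := by
  set z : Fin n → ℕ → ℝ := fun i => extendZero (y i) with hz
  set c := center K z with hcdef
  have hR0 : 0 < R := by rw [hR]; positivity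
  have hε1 : ε ≤ 1 := by linarith
  set D : ℕ → Bool → EuclideanSpace ℝ (Fin T) := fun j b =>
    WithLp.toLp 2 fun t : Fin T => clampedMedian (ε ^ (4 * j)) (bits K R ε j b z) t -
      meanParam ν R ε c j b t with hD
  have hDn : ∀ j ∈ Finset.range T, ∀ b, ‖D j b‖ ≤ 189 * ε ^ (j + 1) := by
    intro j hj b
    rw [hD]
    simp only
    rw [norm_toLp_eq]
    -- The shift by `ε ^ (4 * j)` in `bitParam` puts the mean parameters into `[π / 3, 2 π / 3]`
    -- with `π = ε ^ (4 * j)`, as the clamping requires.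
    have hp : ∀ s, 0 ≤ (if h : s < T then sliceMean (ν ⟨s, h⟩) R (c s) j b else 0) ∧
        (if h : s < T then sliceMean (ν ⟨s, h⟩) R (c s) j b else 0) ≤ ε ^ (4 * j) := by
      intro s
      split_ifs with h
      · refine ⟨sliceMean_nonneg _ _ _ _ _, (sliceMean_le_measureReal hR0 _ j b).trans ?_⟩
        rw [hR]
        exact (hν ⟨s, h⟩).measureReal_le hK hε0 hε hL (hc ⟨s, h⟩) j
      · exact ⟨le_rfl, by positivity⟩
    have h := clampedMedian_error (T := T) (j := j) hn (ψ := bits K R ε j b z)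
      (fun i s => bitParam_nonneg hε0 _ _ _ _ _) (fun i s => bitParam_le_one hε0 hε1 _ _ _ _ _)
      (p := meanParam ν R ε c j b) hε0 hε
      (fun s => by have := (hp s).1; unfold meanParam; linarith)
      (fun s => by have := (hp s).2; unfold meanParam; linarith)
      (fun A => by
        have := hA j (Finset.mem_range.1 hj) b A
        rwa [avg_historyProb, integral_historyProb hε0 hε1] at this)
    rwa [Finset.sum_range] at h
  -- `E` is the truncation error: with `T` slices per side the factor `T` from the sum over
  -- coordinates is absorbed by `ε ^ T`.
  set E : EuclideanSpace ℝ (Fin T) := WithLp.toLp 2 fun t : Fin T =>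
    c t + R * ∑ j ∈ Finset.range T, (sliceMean (ν t) R (c t) j true - sliceMean (ν t) R (c t) j false) -
      ∫ z, z ∂(ν t) with hE
  have hEn : ‖E‖ ≤ 2 * R * ε := by
    rw [hE, norm_toLp_eq]
    have h1 : ∀ t : Fin T, (c t + R * ∑ j ∈ Finset.range T,
        (sliceMean (ν t) R (c t) j true - sliceMean (ν t) R (c t) j false) - ∫ z, z ∂(ν t)) ^ 2 ≤
        (2 * R * ε ^ (4 * T)) ^ 2 := fun t => by
      rw [← sq_abs]
      gcongr
      exact (hν t).abs_sub_sum_sliceMean_le hK hε0 hε hL (hc t) T hR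
    have h2 : (T : ℝ) * (ε ^ T) ≤ 1 := by
      have h3 : ε ^ T ≤ (1 / 2) ^ T := by gcongr; linarith
      have h4 : (T : ℝ) < 2 ^ T := by exact_mod_cast Nat.lt_two_pow_self
      calc (T : ℝ) * ε ^ T ≤ 2 ^ T * (1 / 2) ^ T := by gcongr
        _ = 1 := by rw [← mul_pow]; norm_num
    have h5 : (T : ℝ) * (2 * R * ε ^ (4 * T)) ^ 2 ≤ (2 * R * ε) ^ 2 := by
      have h6 : (ε ^ (4 * T)) ^ 2 ≤ ε ^ T * ε ^ 2 := by
        rw [← pow_mul, ← pow_add]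
        exact pow_le_pow_of_le_one hε0.le hε1 (by lia)
      calc (T : ℝ) * (2 * R * ε ^ (4 * T)) ^ 2 = T * (2 * R) ^ 2 * (ε ^ (4 * T)) ^ 2 := by ring
        _ ≤ T * (2 * R) ^ 2 * (ε ^ T * ε ^ 2) := by gcongr
        _ = (T * ε ^ T) * (2 * R * ε) ^ 2 := by ring
        _ ≤ 1 * (2 * R * ε) ^ 2 := by gcongr
        _ = _ := one_mul _
    refine Real.sqrt_le_iff.2 ⟨by positivity, ?_⟩
    refine (Finset.sum_le_sum fun t _ => h1 t).trans ?_
    simpa using h5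
  have hdecomp : (WithLp.toLp 2 fun t : Fin T => meanEstimate K R ε T z t - ∫ z, z ∂(ν t) :
      EuclideanSpace ℝ (Fin T)) =
      E + R • ∑ j ∈ Finset.range T, ((3 : ℝ) • D j true - (3 : ℝ) • D j false) := by
    ext t
    simp only [hE, hD, PiLp.add_apply, PiLp.smul_apply, WithLp.ofLp_sum, Finset.sum_apply,
      PiLp.sub_apply, smul_eq_mul, meanEstimate, sliceEstimate, meanParam, Fin.is_lt, dif_pos,
      Fin.eta]
    have e : ∀ j ∈ Finset.range T, (3 * clampedMedian (ε ^ (4 * j)) (bits K R ε j true z) t - ε ^ (4 * j) -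
        (3 * clampedMedian (ε ^ (4 * j)) (bits K R ε j false z) t - ε ^ (4 * j))) =
        (sliceMean (ν t) R (c t) j true - sliceMean (ν t) R (c t) j false) +
        (3 * (clampedMedian (ε ^ (4 * j)) (bits K R ε j true z) t -
            (ε ^ (4 * j) + sliceMean (ν t) R (c t) j true) / 3) -
          3 * (clampedMedian (ε ^ (4 * j)) (bits K R ε j false z) t -
            (ε ^ (4 * j) + sliceMean (ν t) R (c t) j false) / 3)) := fun j _ => by ring
    rw [Finset.sum_congr rfl e, Finset.sum_add_distrib]
    ring
  rw [← norm_toLp_eq, hdecomp]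
  have hsum : ‖∑ j ∈ Finset.range T, ((3 : ℝ) • D j true - (3 : ℝ) • D j false)‖ ≤
      1134 * (2 * ε) := by
    refine (norm_sum_le _ _).trans ?_
    calc ∑ j ∈ Finset.range T, ‖(3 : ℝ) • D j true - (3 : ℝ) • D j false‖
        ≤ ∑ j ∈ Finset.range T, 1134 * ε ^ (j + 1) := by
          refine Finset.sum_le_sum fun j hj => (norm_sub_le _ _).trans ?_
          rw [norm_smul, norm_smul, Real.norm_of_nonneg (by norm_num : (0 : ℝ) ≤ 3)]
          linarith [hDn j hj true, hDn j hj false]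
      _ ≤ _ := by
          rw [← Finset.mul_sum]
          have := sum_pow_succ_le hε0 (by linarith) T
          linarith
  calc _ ≤ ‖E‖ + R * ‖∑ j ∈ Finset.range T, ((3 : ℝ) • D j true - (3 : ℝ) • D j false)‖ := by
        refine (norm_add_le _ _).trans ?_
        rw [norm_smul, Real.norm_of_nonneg hR0.le]
    _ ≤ 2 * R * ε + R * (1134 * (2 * ε)) := by gcongr
    _ = _ := by rw [hR]; ring

/-! ### A finite family of test functions. -/

lemma historyProb_congr {T : ℕ} {R ε : ℝ} {c d : ℕ → ℝ} (h : ∀ s < T, c s = d s) (j : ℕ)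
    (b : Bool) (A : Finset (Fin T → Bool)) :
    historyProb R ε c j b A = historyProb R ε d j b A := by
  funext a
  exact Finset.sum_congr rfl fun g _ => cell_congr (fun s hs => by rw [h s hs]) g

lemma abs_mul_floor_sub_le {K m μ : ℝ} (hK : 0 < K) (h : |m - μ| < 3 * K) :
    |K * ⌊m / K⌋ - μ| ≤ 4 * K := by
  have h1 : K * (m / K) = m := by field_simp
  have h2 := mul_le_mul_of_nonneg_left (Int.floor_le (m / K)) hK.le
  have h3 := mul_le_mul_of_nonneg_left (Int.lt_floor_add_one (m / K)).le hK.le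
  have := abs_lt.1 h
  exact abs_le.2 ⟨by linarith, by linarith⟩

/-- The median is determined only by the corrupted data, but its rounded value takes one of 7 values
known in advance, which permits a union bound. -/
lemma exists_floor_eq {K m μ : ℝ} (hK : 0 < K) (h : |m - μ| < 3 * K) :
    ∃ o : Fin 7, ⌊m / K⌋ = ⌊μ / K⌋ - 3 + (o : ℕ) := by
  have h1 := abs_lt.1 h
  have h2 : m / K ≤ μ / K + 3 := by
    rw [div_add' _ _ _ hK.ne']; gcongr; linarith
  have h3 : μ / K - 3 ≤ m / K := by
    rw [div_sub' hK.ne']; gcongr; linarith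
  have h4 := Int.floor_le_floor h2
  have h5 := Int.floor_le_floor h3
  rw [show μ / K + 3 = μ / K + (3 : ℤ) by norm_num, Int.floor_add_intCast] at h4
  rw [show μ / K - 3 = μ / K - (3 : ℤ) by norm_num, Int.floor_sub_intCast] at h5
  refine ⟨⟨(⌊m / K⌋ - (⌊μ / K⌋ - 3)).toNat, by lia⟩, ?_⟩
  simp only
  lia

/-- The test functions: far deviations of each coordinate, and the probabilities of all sets of
histories for all choices of the centers near the means `μ`. -/
noncomputable def testFun {T : ℕ} (K R ε : ℝ) (μ : Fin T → ℝ) :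
    Fin T ⊕ ((Fin T → Fin 7) × Bool × Fin T × Finset (Fin T → Bool)) → (Fin T → ℝ) → ℝ
  | .inl t, a => if 3 * K ≤ |a t - μ t| then 1 else 0
  | .inr (o, b, j, A), a => historyProb R ε
      (fun s => if h : s < T then K * ((⌊μ ⟨s, h⟩ / K⌋ - 3 + (o ⟨s, h⟩ : ℕ) : ℤ) : ℝ) else 0) j b A a

lemma measurable_testFun {T : ℕ} (K R ε : ℝ) (μ : Fin T → ℝ) (k) :
    Measurable (testFun K R ε μ k) := by
  rcases k with t | ⟨o, b, j, A⟩
  · exact Measurable.ite (measurableSet_le measurable_const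
      ((measurable_pi_apply t).sub_const _).abs) measurable_const measurable_const
  · exact measurable_historyProb _ _ _ _ _ _

lemma testFun_nonneg {T : ℕ} {ε : ℝ} (hε0 : 0 < ε) (hε1 : ε ≤ 1) (K R : ℝ) (μ : Fin T → ℝ) (k)
    (a : Fin T → ℝ) : 0 ≤ testFun K R ε μ k a := by
  rcases k with t | ⟨o, b, j, A⟩
  · simp only [testFun]; split_ifs <;> norm_num
  · exact historyProb_nonneg hε0 hε1 _ _ _ _ _ _

lemma testFun_le_one {T : ℕ} {ε : ℝ} (hε0 : 0 < ε) (hε1 : ε ≤ 1) (K R : ℝ) (μ : Fin T → ℝ) (k)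
    (a : Fin T → ℝ) : testFun K R ε μ k a ≤ 1 := by
  rcases k with t | ⟨o, b, j, A⟩
  · simp only [testFun]; split_ifs <;> norm_num
  · exact historyProb_le_one hε0 hε1 _ _ _ _ _ _

lemma integral_testFun_inl_le {T : ℕ} {ν : Fin T → Measure ℝ} [∀ t, IsProbabilityMeasure (ν t)]
    {K : ℝ} (hK : 0 < K) (hν : ∀ t, IsSubgaussian K (ν t)) (R ε : ℝ) (t : Fin T) :
    ∫ a, testFun K R ε (fun t => ∫ z, z ∂(ν t)) (.inl t) a ∂(Measure.pi ν) ≤ 4 / 11 := by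
  set S := {x : ℝ | 3 * K ≤ |x - ∫ z, z ∂(ν t)|} with hS
  have hSm : MeasurableSet S := measurableSet_le measurable_const (measurable_id.sub_const _).abs
  have hmp := measurePreserving_eval ν t
  have e : ∀ a : Fin T → ℝ, testFun K R ε (fun t => ∫ z, z ∂(ν t)) (.inl t) a =
      (Function.eval t ⁻¹' S).indicator 1 a := fun a => by
    simp only [testFun, Set.indicator, Set.mem_preimage, hS, Set.mem_ofPred_eq, Function.eval,
      Pi.one_apply]
  rw [integral_congr_ae (Filter.Eventually.of_forall e),
    integral_indicator_one (hmp.measurable hSm), Measure.real, hmp.measure_preimage hSm.nullMeasurableSet]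
  refine (ENNReal.toReal_le_of_le_ofReal (by positivity) ((hν t).2 (3 * K) (by positivity))).trans ?_
  have e2 : -(3 * K) ^ 2 / (2 * K ^ 2) = -(9 / 2) := by field_simp; norm_num
  rw [e2, Real.exp_neg]
  have h1 : (11 / 2 : ℝ) ≤ Real.exp (9 / 2) := by
    have := Real.add_one_le_exp (9 / 2 : ℝ); linarith
  calc 2 * (Real.exp (9 / 2))⁻¹ ≤ 2 * (11 / 2 : ℝ)⁻¹ := by gcongr
    _ = 4 / 11 := by norm_num

/-- The estimator is accurate on every corruption of a clean data set that is typical. -/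
theorem sliceEstimator_error {n T : ℕ} (hn : 0 < n) (hT : 0 < T) {ν : Fin T → Measure ℝ}
    [∀ t, IsProbabilityMeasure (ν t)] {K R ε : ℝ} (hK : 0 < K) (hν : ∀ t, IsSubgaussian K (ν t))
    (hε0 : 0 < ε) (hε : ε ≤ 1 / 64) (hL : 1 ≤ Real.log (1 / ε))
    (hR : R = 8 * K * √(Real.log (1 / ε))) {x y : Dataset n T} (hxy : IsCorruption ε x y)
    (hx : ∀ k, |avg (testFun K R ε (fun t => ∫ z, z ∂(ν t)) k) x -
      ∫ a, testFun K R ε (fun t => ∫ z, z ∂(ν t)) k a ∂(Measure.pi ν)| ≤ ε)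
    (ω : (sliceEstimator n T K R ε).Seed) :
    √(∑ t : Fin T, ((sliceEstimator n T K R ε).output ω y t - ∫ a, a t ∂(Measure.pi ν)) ^ 2) ≤
      18160 * K * (ε * √(Real.log (1 / ε))) := by
  have hε1 : ε ≤ 1 := by linarith
  have hmean : ∀ t, ∫ a, a t ∂(Measure.pi ν) = ∫ z, z ∂(ν t) := fun t => by
    have hmp := measurePreserving_eval ν t
    have := integral_map (μ := Measure.pi ν) (φ := Function.eval t) (f := fun z : ℝ => z)
      hmp.measurable.aemeasurable measurable_id.aestronglyMeasurable
    rw [hmp.map_eq] at this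
    exact this.symm
  simp only [sliceEstimator_output, hmean]
  set μ : Fin T → ℝ := fun t => ∫ z, z ∂(ν t) with hμ
  have hy : ∀ k, |avg (testFun K R ε μ k) y - ∫ a, testFun K R ε μ k a ∂(Measure.pi ν)| ≤ 2 * ε := by
    intro k
    have h1 := hxy.abs_avg_sub_le hn (testFun_nonneg hε0 hε1 K R μ k) (testFun_le_one hε0 hε1 K R μ k)
    have h2 := hx k
    have := abs_sub_le (avg (testFun K R ε μ k) y) (avg (testFun K R ε μ k) x)
      (∫ a, testFun K R ε μ k a ∂(Measure.pi ν))
    linarith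
  have hmed : ∀ t : Fin T, |weightedMedian (fun _ : Fin n => (1 : ℝ) / n)
      (fun i => extendZero (y i) t) - μ t| < 3 * K := by
    intro t
    refine abs_weightedMedian_sub_lt hn ?_
    have h1 := integral_testFun_inl_le hK hν R ε t
    have h2 := (abs_le.1 (hy (.inl t))).2
    have e : (∑ i, if 3 * K ≤ |extendZero (y i) t - μ t| then (1 : ℝ) else 0) / n =
        avg (testFun K R ε μ (.inl t)) y := by
      simp [avg, testFun, extendZero]
    rw [e]
    -- At most a fraction `4 / 11 + 2 ε < 1 / 2` of the corrupted samples deviate by `3 K`.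
    linarith
  choose o ho using fun t => exists_floor_eq hK (hmed t)
  refine meanEstimate_error hn hT hK hν hε0 hε hL hR (fun t => abs_mul_floor_sub_le hK (hmed t)) ?_
  intro j hj b A
  have hc : ∀ s < T, center K (fun i => extendZero (y i)) s =
      if h : s < T then K * ((⌊μ ⟨s, h⟩ / K⌋ - 3 + (o ⟨s, h⟩ : ℕ) : ℤ) : ℝ) else 0 := by
    intro s hs
    rw [dif_pos hs, ← ho ⟨s, hs⟩]
    rfl
  have := hy (.inr (o, b, ⟨j, hj⟩, A))
  rw [historyProb_congr hc]
  exact this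

/-! ### Sample size and conclusion. -/

lemma card_mul_exp_le {T n : ℕ} {C ε τ : ℝ} (hT : 0 < T) (hC : 10 ≤ C) (hε0 : 0 < ε) (hτ0 : 0 < τ)
    (hτ1 : τ < 1)
    (hn : 2 ^ T * (C * ((T : ℝ) * (1 / ε)) ^ 2) * Real.log (2 / τ) ≤ n) :
    2 * (Fintype.card (Fin T ⊕ ((Fin T → Fin 7) × Bool × Fin T × Finset (Fin T → Bool))) : ℝ) *
      Real.exp (-(2 * n * ε ^ 2)) ≤ τ := by
  set N := 2 ^ T with hN
  have hTN : T ≤ N := Nat.lt_two_pow_self.le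
  have hN1 : 1 ≤ N := Nat.one_le_two_pow
  have hNN : N ≤ 2 ^ N := Nat.lt_two_pow_self.le
  have hcard : Fintype.card (Fin T ⊕ ((Fin T → Fin 7) × Bool × Fin T × Finset (Fin T → Bool))) ≤
      2 ^ (20 * N - 1) := by
    simp only [Fintype.card_sum, Fintype.card_prod, Fintype.card_fun, Fintype.card_fin,
      Fintype.card_bool, Fintype.card_finset]
    have h7 : 7 ^ T ≤ 2 ^ (3 * N) := by
      calc 7 ^ T ≤ 8 ^ T := Nat.pow_le_pow_left (by norm_num) T
        _ = 2 ^ (3 * T) := by rw [pow_mul]; norm_num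
        _ ≤ 2 ^ (3 * N) := Nat.pow_le_pow_right (by norm_num) (by lia)
    calc T + 7 ^ T * (2 * (T * 2 ^ N)) ≤ 2 ^ N + 2 ^ (3 * N) * (2 * (2 ^ N * 2 ^ N)) := by
          gcongr <;> lia
      _ = 2 ^ N + 2 ^ (5 * N + 1) := by ring
      _ ≤ 2 ^ (5 * N + 1) + 2 ^ (5 * N + 1) := by gcongr <;> lia
      _ = 2 ^ (5 * N + 2) := by ring
      _ ≤ _ := Nat.pow_le_pow_right (by norm_num) (by lia)
  have hlog : 0 < Real.log (2 / τ) := Real.log_pos (by rw [lt_div_iff₀ hτ0]; linarith)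
  have hexp : Real.exp (-(2 * n * ε ^ 2)) ≤ (τ / 2) ^ (20 * N) := by
    have e : (τ / 2) ^ (20 * N) = Real.exp (-((20 * N : ℕ) * Real.log (2 / τ))) := by
      rw [← mul_neg, ← Real.log_inv, inv_div, Real.exp_nat_mul, Real.exp_log (by positivity)]
    rw [e, Real.exp_le_exp, neg_le_neg_iff]
    have hT1 : (1 : ℝ) ≤ T := by exact_mod_cast hT
    have h1 : 2 ^ T * (C * ((T : ℝ) * (1 / ε)) ^ 2) * Real.log (2 / τ) * ε ^ 2 ≤ n * ε ^ 2 := by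
      gcongr
    have e2 : 2 ^ T * (C * ((T : ℝ) * (1 / ε)) ^ 2) * Real.log (2 / τ) * ε ^ 2 =
        2 ^ T * (C * (T : ℝ) ^ 2) * Real.log (2 / τ) := by
      field_simp
    rw [e2] at h1
    have h2 : (2 : ℝ) ^ T * 10 * Real.log (2 / τ) ≤
        2 ^ T * (C * (T : ℝ) ^ 2) * Real.log (2 / τ) := by
      gcongr; nlinarith
    rw [hN]; push_cast
    linarith
  -- One factor `τ / 2` is kept for the failure probability; the others, each at most `1 / 2`,
  -- cancel the number of test functions.
  have hhalf : (τ / 2) ^ (20 * N) ≤ τ / 2 * (1 / 2) ^ (20 * N - 1) := by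
    obtain ⟨m, hm⟩ : ∃ m, 20 * N = m + 1 := ⟨20 * N - 1, by lia⟩
    rw [hm, pow_succ', Nat.add_sub_cancel]
    gcongr
  calc _ ≤ 2 * ((2 ^ (20 * N - 1) : ℕ) : ℝ) * (τ / 2 * (1 / 2) ^ (20 * N - 1)) := by
        gcongr
        exact hexp.trans hhalf
    _ = τ * (2 * (1 / 2)) ^ (20 * N - 1) := by rw [mul_pow]; push_cast; ring
    _ = τ := by norm_num

theorem corollary4p15 :
    ∃ ε₀ : ℝ, 0 < ε₀ ∧ ε₀ < 1 / 2 ∧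
      ∀ K : ℝ, 0 < K →
        ∃ (C : ℝ) (k : ℕ), 0 < C ∧
          ∀ (T n : ℕ) (ε τ : ℝ), 0 < T → 0 < ε → ε ≤ ε₀ → 0 < τ → τ < 1 →
            2 ^ T * (C * ((T : ℝ) * (1 / ε)) ^ k) * Real.log (2 / τ) ≤ (n : ℝ) →
            ∃ A : OnlineEstimator n T,
              ∀ ν : Fin T → Measure ℝ,
                (∀ t, IsProbabilityMeasure (ν t)) →
                (∀ t, IsSubgaussian K (ν t)) →
                (∀ t, variance id (ν t) = 1) →
                A.RobustlyEstimates (Measure.pi ν) ε (C * (ε * √(Real.log (1 / ε)))) τ := by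
  refine ⟨1 / 64, by norm_num, by norm_num, fun K hK => ⟨10 + 18160 * K, 2, by positivity, ?_⟩⟩
  intro T n ε τ hT hε0 hε hτ0 hτ1 hnT
  set R := 8 * K * √(Real.log (1 / ε)) with hR
  refine ⟨sliceEstimator n T K R ε, fun ν hprob hν _ π hπ hcorr => ?_⟩
  have hlog : 0 < Real.log (2 / τ) := Real.log_pos (by rw [lt_div_iff₀ hτ0]; linarith)
  have hn : 0 < n := by
    have : (0 : ℝ) < n := lt_of_lt_of_le (by positivity) hnT
    exact_mod_cast this
  have hL : 1 ≤ Real.log (1 / ε) := by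
    rw [Real.le_log_iff_exp_le (by positivity)]
    have h1 : 64 ≤ 1 / ε := by rw [le_div_iff₀ hε0]; linarith
    linarith [Real.exp_one_lt_d9]
  -- The total mass of `π` is that of its first marginal.
  have hπ1 : IsProbabilityMeasure π := by
    refine ⟨?_⟩
    have := congrArg (fun m => m Set.univ) hπ
    rw [Measure.map_apply measurable_fst MeasurableSet.univ, Set.preimage_univ] at this
    exact this.trans measure_univ
  set B := {x : Dataset n T | ∃ k, ε < |avg (testFun K R ε (fun t => ∫ z, z ∂(ν t)) k) x -
      ∫ a, testFun K R ε (fun t => ∫ z, z ∂(ν t)) k a ∂(Measure.pi ν)|} with hB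
  have hBle : π (Prod.fst ⁻¹' B) ≤ ENNReal.ofReal τ := by
    -- The bad event concerns the clean data alone, so no adversary can influence it. This
    -- inequality holds for any set, so measurability of `B` is not needed.
    refine (Measure.le_map_apply measurable_fst.aemeasurable B).trans ?_
    rw [hπ]
    exact (pi_exists_abs_avg_sub_integral_le hn (measurable_testFun K R ε _)
      (testFun_nonneg hε0 (by linarith) K R _) (testFun_le_one hε0 (by linarith) K R _) hε0.le).trans
      (ENNReal.ofReal_le_ofReal (card_mul_exp_le hT (by linarith) hε0 hτ0 hτ1 hnT))
  set S := Prod.fst ⁻¹' B ∪ {p : Dataset n T × Dataset n T | ¬ IsCorruption ε p.1 p.2} with hS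
  have hSle : π S ≤ ENNReal.ofReal τ := by
    refine (measure_union_le _ _).trans ?_
    rw [ae_iff.1 hcorr, add_zero]
    exact hBle
  calc _ ≤ (π.prod (sliceEstimator n T K R ε).law) (S ×ˢ Set.univ) := by
        refine measure_mono fun q hq => ⟨?_, Set.mem_univ _⟩
        by_contra hcon
        rw [hS, Set.mem_union, not_or] at hcon
        refine absurd (show _ < _ from hq) (not_lt.2 ((sliceEstimator_error hn hT hK hν hε0 hε hL hR
          (not_not.1 hcon.2) (fun k => ?_) q.2).trans ?_))
        · by_contra hk
          exact hcon.1 ⟨k, not_le.1 hk⟩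
        · gcongr; linarith
    _ = π S := by rw [Measure.prod_prod, measure_univ, mul_one]
    _ ≤ _ := hSle
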